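/- Let $F$ be an algebraically closed field of characteristic $0$, let $V$ be an abelian Lie algebra over $F$ with basis $v_0,\dots,v_{n-1}$, let $\lambda\in F$, $\lambda\neq 0$, and let $x\in \mathrm{GL}(V)$ act on $V$ by the lower triangular Jordan block $J_n(\lambda)$ relative to this basis, that is, $xv_i=\lambda v_i+v_{i+1}$ for $0\le i<n-1$ and $xv_{n-1}=\lambda v_{n-1}$. Let $\mathfrak g=\langle x\rangle\ltimes V$ be the Lie algebra with $[x,v]=xv$ for $v\in V$. A representation is uniserial if its space is nonzero and its subrepresentations form a chain under inclusion. Write $J^m(\beta)$ for the upper triangular Jordan block of size $m$ and eigenvalue $\beta$, and consider the following matrix representations of $\mathfrak g$, where $\alpha\in F$ is arbitrary and where, in the first two items, $v_i\mapsto (\mathrm{ad}\,A-\lambda 1)^iE$ for $0\le i\le n-1$. * For $1\le k\le n$ and $X\in M_{(k-1)\times(n-k)}(F)$, the representation $R_{\alpha,k,X}:\mathfrak g\to\mathfrak{gl}(n+1)$ with $x\mapsto A=J^k(\alpha)\oplus J^{n+1-k}(\alpha-\lambda)$ and $E=\begin{pmatrix}0&N\\0&0\end{pmatrix}$, $N=\begin{pmatrix}0&X\\1&0\end{pmatrix}\in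 M_{k\times(n+1-k)}(F)$. For $k=n$ and $k=1$ the matrix $X$ is empty, and the representation is denoted by $R_{\alpha,n}$ and $R_{\alpha,1}$ respectively; the notation $R_{\alpha,k,X}$ is then reserved for $1<k<n$. * For $n$ odd and $a=(a_1,\dots,a_n)\in F^n$ with $a_1=1$ and $a_i=0$ for all even $i$, the representation $R_{\alpha,a}:\mathfrak g\to\mathfrak{gl}(n+2)$ with $x\mapsto A=(\alpha)\oplus J^n(\alpha-\lambda)\oplus(\alpha-2\lambda)$ and $E=\begin{pmatrix}0&a&0\\0&0&e_n\\0&0&0\end{pmatrix}$, where $e_n$ is the last canonical column vector of $F^n$. * For $n=1$ and $\ell\ge 2$, the representation $T_{\alpha,\ell}:\mathfrak g\to\mathfrak{gl}(\ell)$ with $x\mapsto \mathrm{diag}(\alpha,\alpha-\lambda,\dots,\alpha-(\ell-1)\lambda)$ and $v_0\mapsto J^\ell(0)$. Let $R$ be a faithful uniserial finite-dimensional representation of $\mathfrak g$ over $F$. (a) If $n>1$, then $R$ is isomorphic to one and only one of the representations $R_{\alpha,k,X}$ ($\alpha\in F$, $1<k<n$, $X\in M_{(k-1)\times(n-k)}(F)$),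 $R_{\alpha,n}$ ($\alpha\in F$), $R_{\alpha,1}$ ($\alpha\in F$), $R_{\alpha,a}$ ($\alpha\in F$, $n$ odd, $a$ as above). (b) If $n=1$, then $R$ is isomorphic to one and only one of the representations $T_{\alpha,\ell}$ ($\alpha\in F$, $\ell\ge 2$). -/

import Mathlib

open Matrix

attribute [local instance 100] LieRing.ofAssociativeRing

/-! ### The Lie algebra `⟨x⟩ ⋉ V` -/

section LieAlg

variable {F V : Type*} [Field F] [LieRing V] [LieAlgebra F V] [IsLieAbelian V]

/-- A linear endomorphism of an abelian Lie algebra, viewed as a derivation. -/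
def abelianDer (f : Module.End F V) : LieDerivation F V V where
  toLinearMap := f
  leibniz' a b := by simp [trivial_lie_zero]

/-- The action of the one-dimensional Lie algebra `F` (with generator `1`) on the abelian
Lie algebra `V` by derivations, the generator acting through `x`. -/
def lineAction (x : Module.End F V) : F →ₗ⁅F⁆ LieDerivation F V V where
  toFun t := t • abelianDer x
  map_add' s t := add_smul s t _
  map_smul' s t := by simp [mul_smul]
  map_lie' {s t} := by
    rw [Ring.lie_def, mul_comm, sub_self, zero_smul]
    change (0 : LieDerivation F V V) = ⁅s • abelianDer x, t • abelianDer x⁆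
    ext w
    simp only [LieDerivation.commutator_apply, LieDerivation.coe_smul, Pi.smul_apply, map_smul,
      LieDerivation.coe_zero, Pi.zero_apply]
    rw [smul_comm, sub_self]

/-- The Lie algebra `⟨x⟩ ⋉ V`: its elements are the pairs `⟨w, t⟩` with `w ∈ V`, `t ∈ F`
(standing for `w + t x`), and `⁅x, w⁆ = x w`. -/
abbrev LineSemidirect (x : Module.End F V) : Type _ :=
  LieAlgebra.SemiDirectSum V F (lineAction x)

theorem LineSemidirect.lie_eq (x : Module.End F V) (y z : LineSemidirect x) :
    ⁅y, z⁆ = ⟨y.right • x z.left - z.right • x y.left, 0⟩ := by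
  rw [LieAlgebra.SemiDirectSum.lie_eq_mk]
  have h : ⁅y.right, z.right⁆ = 0 := by rw [Ring.lie_def, mul_comm, sub_self]
  rw [h, trivial_lie_zero, zero_add]
  rfl

end LieAlg

/-! ### Jordan blocks -/

/-- The lower triangular Jordan block `J_n(a)`. -/
def lowerJordan {F : Type*} [Field F] (n : ℕ) (a : F) : Matrix (Fin n) (Fin n) F :=
  Matrix.of fun i j => if i = j then a else if i.val = j.val + 1 then 1 else 0

/-- The upper triangular Jordan block `J^n(a)`. -/
def upperJordan {F : Type*} [Field F] (n : ℕ) (a : F) : Matrix (Fin n) (Fin n) F :=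
  Matrix.of fun i j => if i = j then a else if j.val = i.val + 1 then 1 else 0

section JordanFacts

variable {F : Type*} [Field F]

theorem upperJordan_eq (n : ℕ) (a : F) :
    upperJordan n a = upperJordan n 0 + a • (1 : Matrix (Fin n) (Fin n) F) := by
  ext i j
  by_cases h : i = j <;> simp [upperJordan, h]

theorem upperJordan_pow_apply (n k : ℕ) (i j : Fin n) :
    (upperJordan n (0 : F) ^ k) i j = if j.val = i.val + k then 1 else 0 := by
  induction k generalizing j with
  | zero => simp [Matrix.one_apply, Fin.ext_iff, eq_comm]
  | succ k ih =>
    rw [pow_succ, Matrix.mul_apply]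
    simp only [ih, ite_mul, one_mul, zero_mul]
    by_cases hik : i.val + k < n
    · rw [Finset.sum_eq_single (⟨i.val + k, hik⟩ : Fin n)]
      · simp only [upperJordan, Matrix.of_apply, Fin.ext_iff, if_true]
        split_ifs <;> first | rfl | omega
      · intro b _ hb
        rw [if_neg]
        intro h
        exact hb (Fin.ext h)
      · simp
    · rw [Finset.sum_eq_zero, if_neg]
      · omega
      · intro b _
        rw [if_neg]
        omega

theorem upperJordan_pow_self (n : ℕ) : upperJordan n (0 : F) ^ n = 0 := by
  ext i j
  rw [upperJordan_pow_apply, if_neg (by omega)]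
  rfl

end JordanFacts

/-! ### Representations -/

section Reps

variable {F L U : Type*} [Field F] [LieRing L] [LieAlgebra F L] [AddCommGroup U] [Module F U]

/-- A representation is uniserial if its space is nonzero and the invariant subspaces
form a chain. -/
def IsUniserialRep (R : L →ₗ⁅F⁆ Module.End F U) : Prop :=
  Nontrivial U ∧
    ∀ W W' : Submodule F U, (∀ y : L, ∀ u ∈ W, R y u ∈ W) → (∀ y : L, ∀ u ∈ W', R y u ∈ W') →
      W ≤ W' ∨ W' ≤ W

/-- The representation `R` is isomorphic to the matrix representation `S` (acting on
column vectors). -/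
def IsoToMatrixRep {ι : Type*} [Fintype ι] [DecidableEq ι]
    (R : L →ₗ⁅F⁆ Module.End F U) (S : L →ₗ⁅F⁆ Matrix ι ι F) : Prop :=
  ∃ T : U ≃ₗ[F] (ι → F), ∀ (y : L) (u : U), T (R y u) = S y *ᵥ T u

end Reps

/-! ### Matrix representations of `⟨x⟩ ⋉ V` when `x` acts through one Jordan block -/

section Construction

variable {F : Type*} [Field F] {ι : Type*} [Fintype ι] [DecidableEq ι]

/-- The operator `ad A - c · 1` on square matrices. -/
def adShift (A : Matrix ι ι F) (c : F) : Module.End F (Matrix ι ι F) :=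
  LieAlgebra.ad F (Matrix ι ι F) A - c • 1

theorem adShift_apply (A : Matrix ι ι F) (c : F) (E : Matrix ι ι F) :
    adShift A c E = A * E - E * A - c • E := by
  simp [adShift, LieAlgebra.ad_apply, Ring.lie_def]

variable {V : Type*} [LieRing V] [LieAlgebra F V]

/-- The linear map `V → gl(ι)` sending `v_k` to `(ad A - c · 1)^k E`. -/
noncomputable def vecPart {n : ℕ} (v : Module.Basis (Fin n) F V) (c : F) (A E : Matrix ι ι F) :
    V →ₗ[F] Matrix ι ι F :=
  v.constr F fun k => (adShift A c ^ k.val) E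

theorem vecPart_basis {n : ℕ} (v : Module.Basis (Fin n) F V) (c : F) (A E : Matrix ι ι F)
    (k : Fin n) : vecPart v c A E (v k) = (adShift A c ^ k.val) E :=
  v.constr_basis F _ k

theorem vecPart_lie {n : ℕ} {x : Module.End F V} {v : Module.Basis (Fin n) F V} {c : F}
    (hx : LinearMap.toMatrix v v x = lowerJordan n c) (A E : Matrix ι ι F)
    (hE : (adShift A c ^ n) E = 0) (w : V) :
    vecPart v c A E (x w) = A * vecPart v c A E w - vecPart v c A E w * A := by
  have key : (vecPart v c A E) ∘ₗ x =
      (LieAlgebra.ad F (Matrix ι ι F) A : Module.End F (Matrix ι ι F)) ∘ₗ vecPart v c A E := by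
    refine v.ext fun k => ?_
    have h1 : x (v k) = ∑ i, lowerJordan n c i k • v i := by
      rw [← hx, ← v.sum_repr (x (v k))]
      simp [LinearMap.toMatrix_apply]
    have h2 : (adShift A c ^ (k.val + 1)) E =
        A * (adShift A c ^ k.val) E - (adShift A c ^ k.val) E * A
          - c • (adShift A c ^ k.val) E := by
      rw [pow_succ', Module.End.mul_apply, adShift_apply]
    simp only [LinearMap.comp_apply, h1, map_sum, map_smul, vecPart_basis, LieAlgebra.ad_apply,
      Ring.lie_def]
    have h3 : ∀ i : Fin n, lowerJordan n c i k • (adShift A c ^ i.val) E =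
        (if i = k then c • (adShift A c ^ k.val) E else 0) +
        (if i.val = k.val + 1 then (adShift A c ^ (k.val + 1)) E else 0) := by
      intro i
      by_cases hik : i = k
      · subst hik
        simp [lowerJordan]
      · by_cases hs : i.val = k.val + 1
        · simp [lowerJordan, hik, hs]
        · simp [lowerJordan, hik, hs]
    rw [Finset.sum_congr rfl fun i _ => h3 i, Finset.sum_add_distrib]
    have h4 : (∑ i : Fin n, if i.val = k.val + 1 then (adShift A c ^ (k.val + 1)) E else 0) =
        (adShift A c ^ (k.val + 1)) E := by
      by_cases hk : k.val + 1 < n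
      · rw [Finset.sum_eq_single (⟨k.val + 1, hk⟩ : Fin n)]
        · simp
        · intro b _ hb
          rw [if_neg]
          intro h
          exact hb (Fin.ext h)
        · simp
      · have : k.val + 1 = n := by omega
        rw [this, hE]
        simp
    rw [h4, h2]
    simp
  simpa [LieAlgebra.ad_apply, Ring.lie_def] using LinearMap.congr_fun key w

variable [IsLieAbelian V]

/-- The matrix representation of `⟨x⟩ ⋉ V` given by `x ↦ A` and
`v_k ↦ (ad A - c · 1)^k E` for `0 ≤ k ≤ n - 1`, where `x` acts on the basis
`v_0, …, v_{n-1}` of `V` by `J_n(c)`. It exists as soon as `(ad A - c · 1)^n E = 0` and the images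
of the `v_k` commute. -/
noncomputable def jordanRep {n : ℕ} {x : Module.End F V} {v : Module.Basis (Fin n) F V} {c : F}
    (hx : LinearMap.toMatrix v v x = lowerJordan n c) (A E : Matrix ι ι F)
    (hE : (adShift A c ^ n) E = 0)
    (hcomm : ∀ i j : Fin n, Commute ((adShift A c ^ i.val) E) ((adShift A c ^ j.val) E)) :
    LineSemidirect x →ₗ⁅F⁆ Matrix ι ι F where
  toFun y := y.right • A + vecPart v c A E y.left
  map_add' y z := by
    simp only [LieAlgebra.SemiDirectSum.add_eq_mk, map_add, add_smul]
    abel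
  map_smul' t y := by
    simp only [LieAlgebra.SemiDirectSum.smul_eq_mk, map_smul, smul_add, smul_eq_mul, mul_smul,
      RingHom.id_apply]
  map_lie' {y z} := by
    have hc : ∀ w w' : V, vecPart v c A E w * vecPart v c A E w' =
        vecPart v c A E w' * vecPart v c A E w := by
      intro w w'
      simp only [vecPart, Module.Basis.constr_apply_fintype]
      refine (Commute.sum_left _ _ _ fun i _ => Commute.sum_right _ _ _ fun j _ => ?_).eq
      exact ((hcomm i j).smul_left _).smul_right _
    change (⁅y, z⁆ : LineSemidirect x).right • A + vecPart v c A E (⁅y, z⁆ : LineSemidirect x).left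
      = _
    rw [LineSemidirect.lie_eq, Ring.lie_def]
    simp only [zero_smul, zero_add, map_sub, map_smul, vecPart_lie hx A E hE, mul_add, add_mul,
      Matrix.smul_mul, Matrix.mul_smul, smul_sub, hc y.left z.left, smul_smul,
      mul_comm z.right y.right]
    abel

end Construction

/-! ### The families `R_{α,k,X}`, `R_{α,n}`, `R_{α,1}` -/

section TwoBlocks

variable {F : Type*} [Field F]

/-- The block diagonal matrix `J^p(α) ⊕ J^q(α - c)`. -/
def twoBlockA (p q : ℕ) (α c : F) : Matrix (Fin p ⊕ Fin q) (Fin p ⊕ Fin q) F :=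
  Matrix.fromBlocks (upperJordan p α) 0 0 (upperJordan q (α - c))

/-- The `k × (n + 1 - k)` matrix with block decomposition `[0, X; 1, 0]`, where
`X` has size `(k - 1) × (n - k)`. -/
def cornerN {n k : ℕ} (X : Matrix (Fin (k - 1)) (Fin (n - k)) F) :
    Matrix (Fin k) (Fin (n + 1 - k)) F :=
  Matrix.of fun i j =>
    if h : i.val < k - 1 ∧ 0 < j.val then
      X ⟨i.val, h.1⟩ ⟨j.val - 1, by have := h.2; have := j.isLt; omega⟩
    else if i.val = k - 1 ∧ j.val = 0 then 1 else 0

theorem adShift_twoBlock (p q : ℕ) (α c : F) (N : Matrix (Fin p) (Fin q) F) :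
    adShift (twoBlockA p q α c) c (Matrix.fromBlocks 0 N 0 0) =
      Matrix.fromBlocks 0 (upperJordan p (0 : F) * N - N * upperJordan q (0 : F)) 0 0 := by
  rw [adShift_apply, twoBlockA, upperJordan_eq p α, upperJordan_eq q (α - c)]
  simp only [Matrix.fromBlocks_multiply, Matrix.fromBlocks_smul, sub_eq_add_neg,
    Matrix.fromBlocks_neg, Matrix.fromBlocks_add]
  congr 1 <;> simp [Matrix.add_mul, Matrix.mul_add, add_smul]
  abel

theorem adShift_twoBlock_pow (p q : ℕ) (α c : F) (N : Matrix (Fin p) (Fin q) F) (k : ℕ) :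
    ∃ M : Matrix (Fin p) (Fin q) F,
      (adShift (twoBlockA p q α c) c ^ k) (Matrix.fromBlocks 0 N 0 0) =
        Matrix.fromBlocks 0 M 0 0 := by
  induction k with
  | zero => exact ⟨N, rfl⟩
  | succ k ih =>
    obtain ⟨M, hM⟩ := ih
    exact ⟨_, by rw [pow_succ', Module.End.mul_apply, hM, adShift_twoBlock]⟩

theorem adShift_twoBlock_nilpotent {n p q : ℕ} (hp : 1 ≤ p) (hq : 1 ≤ q) (hn : p + q ≤ n + 1)
    (α c : F) (N : Matrix (Fin p) (Fin q) F) :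
    (adShift (twoBlockA p q α c) c ^ n) (Matrix.fromBlocks 0 N 0 0) = 0 := by
  set P : Matrix (Fin p ⊕ Fin q) (Fin p ⊕ Fin q) F :=
    Matrix.fromBlocks (upperJordan p 0) 0 0 0 with hP
  set Q : Matrix (Fin p ⊕ Fin q) (Fin p ⊕ Fin q) F :=
    Matrix.fromBlocks 0 0 0 (upperJordan q 0) with hQ
  have hPp : P ^ p = 0 := by
    rw [hP, Matrix.fromBlocks_diagonal_pow, upperJordan_pow_self, zero_pow (by omega),
      Matrix.fromBlocks_zero]
  have hQq : Q ^ q = 0 := by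
    rw [hQ, Matrix.fromBlocks_diagonal_pow, upperJordan_pow_self, zero_pow (by omega),
      Matrix.fromBlocks_zero]
  have hcomm : Commute (LinearMap.mulLeft F P) (-LinearMap.mulRight F Q) :=
    (LinearMap.commute_mulLeft_right (R := F) P Q).neg_right
  have hnil : (LinearMap.mulLeft F P + -LinearMap.mulRight F Q) ^ n = 0 := by
    refine hcomm.add_pow_eq_zero_of_add_le_succ_of_pow_eq_zero (m := p) (n := q) ?_ ?_ hn
    · rw [LinearMap.pow_mulLeft, hPp, LinearMap.mulLeft_zero_eq_zero]
    · rw [neg_pow (LinearMap.mulRight F Q : Module.End F _), LinearMap.pow_mulRight, hQq, LinearMap.mulRight_zero_eq_zero, mul_zero]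
  have hpow : ∀ k : ℕ, (adShift (twoBlockA p q α c) c ^ k) (Matrix.fromBlocks 0 N 0 0) =
      ((LinearMap.mulLeft F P + -LinearMap.mulRight F Q) ^ k) (Matrix.fromBlocks 0 N 0 0) := by
    intro k
    induction k with
    | zero => rfl
    | succ k ih =>
      obtain ⟨M, hM⟩ := adShift_twoBlock_pow p q α c N k
      rw [pow_succ', Module.End.mul_apply, pow_succ', Module.End.mul_apply, ← ih, hM,
        adShift_twoBlock]
      simp [hP, hQ, Matrix.fromBlocks_multiply, Matrix.fromBlocks_neg, Matrix.fromBlocks_add,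
        sub_eq_add_neg]
  rw [hpow, hnil]
  rfl

theorem adShift_twoBlock_commute (p q : ℕ) (α c : F) (N : Matrix (Fin p) (Fin q) F) (i j : ℕ) :
    Commute ((adShift (twoBlockA p q α c) c ^ i) (Matrix.fromBlocks 0 N 0 0))
      ((adShift (twoBlockA p q α c) c ^ j) (Matrix.fromBlocks 0 N 0 0)) := by
  obtain ⟨M, hM⟩ := adShift_twoBlock_pow p q α c N i
  obtain ⟨M', hM'⟩ := adShift_twoBlock_pow p q α c N j
  rw [hM, hM']
  simp [Commute, SemiconjBy, Matrix.fromBlocks_multiply]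

variable {V : Type*} [LieRing V] [LieAlgebra F V] [IsLieAbelian V]

/-- The representation `R_{α,k,X} : ⟨x⟩ ⋉ V → gl(n+1)`, for `1 ≤ k ≤ n` and `X` a
`(k - 1) × (n - k)` matrix:
`x ↦ A = J^k(α) ⊕ J^{n+1-k}(α - c)` and
`v_j ↦ (ad A - c · 1)^j [0, N; 0, 0]` with `N = [0, X; 1, 0]`. -/
noncomputable def repR {n : ℕ} {x : Module.End F V} {v : Module.Basis (Fin n) F V} {c : F}
    (hx : LinearMap.toMatrix v v x = lowerJordan n c)
    (α : F) (k : ℕ) (hk : 1 ≤ k) (hkn : k ≤ n) (X : Matrix (Fin (k - 1)) (Fin (n - k)) F) :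
    LineSemidirect x →ₗ⁅F⁆
      Matrix (Fin k ⊕ Fin (n + 1 - k)) (Fin k ⊕ Fin (n + 1 - k)) F :=
  jordanRep hx (twoBlockA k (n + 1 - k) α c) (Matrix.fromBlocks 0 (cornerN X) 0 0)
    (adShift_twoBlock_nilpotent hk (by omega) (by omega) α c _)
    (fun i j => adShift_twoBlock_commute k (n + 1 - k) α c _ i.val j.val)

end TwoBlocks

/-! ### The family `R_{α,a}` -/

section ThreeBlocks

variable {F : Type*} [Field F]

/-- The index type of `(n+2) × (n+2)` matrices split into blocks of sizes `1, n, 1`. -/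
abbrev ThreeIdx (n : ℕ) : Type := Unit ⊕ (Fin n ⊕ Unit)

/-- The block diagonal matrix `(α) ⊕ J^n(α - c) ⊕ (α - 2 c)`. -/
def threeBlockA (n : ℕ) (α c : F) : Matrix (ThreeIdx n) (ThreeIdx n) F :=
  Matrix.fromBlocks (Matrix.of fun _ _ => α) 0 0
    (Matrix.fromBlocks (upperJordan n (α - c)) 0 0 (Matrix.of fun _ _ => α - 2 * c))

/-- The block matrix `[0, r, 0; 0, 0, s; 0, 0, 0]` with `r` a row and `s` a column
of length `n`. -/
def threeBlockE {n : ℕ} (r s : Fin n → F) : Matrix (ThreeIdx n) (ThreeIdx n) F :=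
  Matrix.fromBlocks 0 (Matrix.fromCols (Matrix.replicateRow Unit r) 0) 0
    (Matrix.fromBlocks 0 (Matrix.replicateCol Unit s) 0 0)

/-- The last canonical vector of `F^n`. -/
def lastVec (F : Type*) [Field F] (n : ℕ) : Fin n → F :=
  fun i => if i.val + 1 = n then 1 else 0

theorem adShift_threeBlock (n : ℕ) (α c : F) (r s : Fin n → F) :
    adShift (threeBlockA n α c) c (threeBlockE r s) =
      threeBlockE (-(r ᵥ* upperJordan n 0)) (upperJordan n 0 *ᵥ s) := by
  rw [adShift_apply, threeBlockA, upperJordan_eq n (α - c)]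
  ext i j
  rcases i with i | i | i <;> rcases j with j | j | j <;>
    simp [threeBlockE, Matrix.fromBlocks_multiply, Matrix.mul_apply, Matrix.vecMul, Matrix.mulVec,
      dotProduct, Matrix.add_apply, mul_add, add_mul, Finset.sum_add_distrib, Matrix.one_apply,
      Matrix.fromCols] <;> ring

theorem adShift_threeBlock_pow (n : ℕ) (α c : F) (r s : Fin n → F) (k : ℕ) :
    (adShift (threeBlockA n α c) c ^ k) (threeBlockE r s) =
      threeBlockE ((-1 : F) ^ k • (r ᵥ* upperJordan n 0 ^ k)) (upperJordan n 0 ^ k *ᵥ s) := by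
  induction k with
  | zero => simp
  | succ k ih =>
    rw [pow_succ', Module.End.mul_apply, ih, adShift_threeBlock]
    congr 1
    · rw [Matrix.smul_vecMul, Matrix.vecMul_vecMul, ← pow_succ, pow_succ (-1 : F)]
      simp
    · rw [Matrix.mulVec_mulVec, ← pow_succ']

theorem threeBlockE_mul {n : ℕ} (r s r' s' : Fin n → F) :
    threeBlockE r s * threeBlockE r' s' =
      Matrix.fromBlocks 0 (Matrix.fromCols 0 (Matrix.of fun _ _ => r ⬝ᵥ s')) 0 0 := by
  ext i j
  rcases i with i | i | i <;> rcases j with j | j | j <;>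
    simp [threeBlockE, Matrix.mul_apply, dotProduct, Matrix.fromCols]

theorem adShift_threeBlock_nilpotent (n : ℕ) (α c : F) (r s : Fin n → F) :
    (adShift (threeBlockA n α c) c ^ n) (threeBlockE r s) = 0 := by
  rw [adShift_threeBlock_pow, upperJordan_pow_self]
  ext i j
  rcases i with i | i | i <;> rcases j with j | j | j <;>
    simp [threeBlockE, Matrix.fromCols]

theorem vecMul_pow_dot_lastVec {n : ℕ} (a : Fin n → F) (m : ℕ) :
    a ⬝ᵥ (upperJordan n 0 ^ m *ᵥ lastVec F n) =
      if h : m < n then a ⟨n - 1 - m, by omega⟩ else 0 := by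
  have hcol : ∀ i : Fin n, (upperJordan n (0 : F) ^ m *ᵥ lastVec F n) i =
      if i.val + m + 1 = n then 1 else 0 := by
    intro i
    have hn : n - 1 < n := by have := i.isLt; omega
    simp only [Matrix.mulVec, dotProduct, upperJordan_pow_apply, lastVec]
    rw [Finset.sum_eq_single (⟨n - 1, hn⟩ : Fin n)]
    · have := i.isLt
      simp only [ite_mul, one_mul, zero_mul]
      split_ifs <;> first | rfl | omega
    · intro b _ hb
      have : ¬ (b.val + 1 = n) := fun h => hb (Fin.ext (by simp; omega))
      simp [this]
    · simp
  simp only [dotProduct, hcol]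
  split_ifs with h
  · rw [Finset.sum_eq_single (⟨n - 1 - m, by omega⟩ : Fin n)]
    · rw [if_pos (by simp; omega), mul_one]
    · intro b _ hb
      rw [if_neg, mul_zero]
      intro hh
      exact hb (Fin.ext (by simp; omega))
    · simp
  · refine Finset.sum_eq_zero fun b _ => ?_
    rw [if_neg (by omega), mul_zero]

theorem adShift_threeBlock_commute {n : ℕ} (α c : F) (a : Fin n → F) (hn : Odd n)
    (ha : ∀ i : Fin n, Even (i.val + 1) → a i = 0) (i j : ℕ) :
    Commute ((adShift (threeBlockA n α c) c ^ i) (threeBlockE a (lastVec F n)))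
      ((adShift (threeBlockA n α c) c ^ j) (threeBlockE a (lastVec F n))) := by
  have key : ∀ i j : ℕ, ((-1 : F) ^ i • (a ᵥ* upperJordan n 0 ^ i)) ⬝ᵥ
      (upperJordan n 0 ^ j *ᵥ lastVec F n) =
      (-1 : F) ^ i * if h : i + j < n then a ⟨n - 1 - (i + j), by omega⟩ else 0 := by
    intro i j
    rw [smul_dotProduct, ← Matrix.dotProduct_mulVec, Matrix.mulVec_mulVec, ← pow_add,
      vecMul_pow_dot_lastVec, smul_eq_mul]
  rw [adShift_threeBlock_pow, adShift_threeBlock_pow, Commute, SemiconjBy, threeBlockE_mul,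
    threeBlockE_mul, key, key]
  have : ((-1 : F) ^ i * if h : i + j < n then a ⟨n - 1 - (i + j), by omega⟩ else 0) =
      (-1 : F) ^ j * if h : j + i < n then a ⟨n - 1 - (j + i), by omega⟩ else 0 := by
    simp only [add_comm j i]
    split_ifs with h
    · rcases Nat.even_or_odd (i + j) with he | ho
      · congr 1
        rcases Nat.even_or_odd i with hi | hi
        · rw [hi.neg_one_pow, ((Nat.even_add.mp he).mp hi).neg_one_pow]
        · have hj : Odd j := by
            rw [← Nat.not_even_iff_odd] at hi ⊢
            exact fun hj => hi ((Nat.even_add.mp he).mpr hj)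
          rw [hi.neg_one_pow, hj.neg_one_pow]
      · rw [ha, mul_zero, mul_zero]
        obtain ⟨m, hm⟩ := hn
        obtain ⟨l, hl⟩ := ho
        exact ⟨m - l, by simp; omega⟩
    · simp
  rw [this]

variable {V : Type*} [LieRing V] [LieAlgebra F V] [IsLieAbelian V]

/-- The representation `R_{α,a} : ⟨x⟩ ⋉ V → gl(n+2)`, for odd `n` and `a = (a_1, …, a_n)` with
`a_i = 0` for all even `i` (indices in `Fin n` start at `0`, so `a_i` is
`a ⟨i - 1, _⟩`):
`x ↦ A = (α) ⊕ J^n(α - c) ⊕ (α - 2 c)` and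
`v_k ↦ (ad A - c · 1)^k [0, a, 0; 0, 0, e_n; 0, 0, 0]`. -/
noncomputable def repRa {n : ℕ} {x : Module.End F V} {v : Module.Basis (Fin n) F V} {c : F}
    (hx : LinearMap.toMatrix v v x = lowerJordan n c)
    (α : F) (a : Fin n → F) (hn : Odd n) (ha : ∀ i : Fin n, Even (i.val + 1) → a i = 0) :
    LineSemidirect x →ₗ⁅F⁆ Matrix (ThreeIdx n) (ThreeIdx n) F :=
  jordanRep hx (threeBlockA n α c) (threeBlockE a (lastVec F n))
    (adShift_threeBlock_nilpotent n α c _ _)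
    (fun i j => adShift_threeBlock_commute α c a hn ha i.val j.val)

end ThreeBlocks

/-! ### The family `T_{α,ℓ}` -/

section OneDim

variable {F : Type*} [Field F]

theorem adShift_diag (l : ℕ) (α c : F) :
    adShift (Matrix.diagonal fun i : Fin l => α - (i.val : F) * c) c (upperJordan l 0) = 0 := by
  rw [adShift_apply]
  ext i j
  simp only [Matrix.sub_apply, Matrix.diagonal_mul, Matrix.mul_diagonal, Matrix.smul_apply,
    upperJordan, Matrix.of_apply, smul_eq_mul, Matrix.zero_apply]
  split_ifs with h1 h2
  · simp
  · rw [h2]; push_cast; ring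
  · simp

variable {V : Type*} [LieRing V] [LieAlgebra F V] [IsLieAbelian V]

/-- The representation `T_{α,l} : ⟨x⟩ ⋉ V → gl(l)`, for `dim V = 1`:
`x ↦ diag(α, α - c, …, α - (l - 1) c)` and `v_0 ↦ J^l(0)`. -/
noncomputable def repT {n : ℕ} {x : Module.End F V} {v : Module.Basis (Fin n) F V} {c : F}
    (hx : LinearMap.toMatrix v v x = lowerJordan n c) (hn : n = 1) (α : F) (l : ℕ) :
    LineSemidirect x →ₗ⁅F⁆ Matrix (Fin l) (Fin l) F :=
  jordanRep hx (Matrix.diagonal fun i : Fin l => α - (i.val : F) * c) (upperJordan l 0)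
    (by subst hn; rw [pow_one, adShift_diag])
    (fun i j => by
      obtain rfl : i = j := by subst hn; exact Subsingleton.elim i j
      exact Commute.refl _)

end OneDim

/-! ### The list of representations for `n > 1` -/

/-- The parameters of the listed representations for `n > 1`. -/
inductive RepParam (F : Type*) [Field F] (n : ℕ) where
  /-- `R_{α,k,X}`, with `1 < k < n` and `X` of size `(k - 1) × (n - k)` -/
  | mid (α : F) (k : ℕ) (hk : 1 < k) (hkn : k < n) (X : Matrix (Fin (k - 1)) (Fin (n - k)) F)
  /-- `R_{α,n}` -/
  | top (α : F)
  /-- `R_{α,1}` -/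
  | bot (α : F)
  /-- `R_{α,a}`, with `n` odd, `a_1 = 1` and `a_i = 0` for all even `i` -/
  | three (α : F) (a : Fin n → F) (hn : Odd n) (ha1 : ∀ i : Fin n, i.val + 1 = 1 → a i = 1)
      (ha : ∀ i : Fin n, Even (i.val + 1) → a i = 0)

/-- `R` is isomorphic to the listed representation with parameter `p`. For `k = n` and `k = 1`
the matrix `X` has no entries, hence is written `0`. -/
def IsoToListed {F V U : Type*} [Field F] [LieRing V] [LieAlgebra F V] [IsLieAbelian V]
    [AddCommGroup U] [Module F U] {n : ℕ} (hn : 1 < n)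
    {x : Module.End F V} {v : Module.Basis (Fin n) F V} {c : F}
    (hx : LinearMap.toMatrix v v x = lowerJordan n c)
    (R : LineSemidirect x →ₗ⁅F⁆ Module.End F U) : RepParam F n → Prop
  | .mid α k hk hkn X => IsoToMatrixRep R (repR hx α k hk.le hkn.le X)
  | .top α => IsoToMatrixRep R (repR hx α n hn.le le_rfl 0)
  | .bot α => IsoToMatrixRep R (repR hx α 1 le_rfl hn.le 0)
  | .three α a hodd _ ha => IsoToMatrixRep R (repRa hx α a hodd ha)

/-! # Uniserial representations of `⟨x⟩ ⋉ V`

Let `A` be the operator by which `x` acts and `B i` the one by which `v_i` acts. The relation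
`[A, B i] = c B i + B (i + 1)` says that `B i` maps the generalized eigenspace of `A` for `μ` into
the one for `μ + c`. In a uniserial representation the eigenvalues therefore form a progression
`α, α - c, …, α - m c`, since otherwise the space would split. Call the generalized eigenspace for
`α - j c` the layer `j`, and let `f_j = A - (α - j c)`, which is nilpotent on it. Adding to a subspace
of a layer all the layers of smaller index turns an `A`-invariant subspace into a subrepresentation,
so on each layer `f_j` is a single nilpotent Jordan block
(`IsUniserialSystem.exists_smul_eq_of_layerShift_eq_zero`); and `B 0` sends an eigenvector of the
layer `j + 1` to a cyclic vector of the layer `j`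
(`IsUniserialSystem.layerShift_pow_B_ne_zero`).

As `f_j B i - B i f_{j+1} = B (i + 1)`, the operators `B k` are given by a binomial formula in `f_j`,
`B 0` and `f_{j+1}`. If the layers `j` and `j + 1` have dimensions `d` and `d'`, the formula has only
one term for `k = d + d' - 2`, and this term is not zero; for larger `k` there is no term. As
`B n = 0`, this gives `d + d' ≤ n + 1`, with equality for some `j` because `B (n - 1) ≠ 0` by
faithfulness. Where equality holds and there is a third layer, the commutation of `B 0` and
`B (n - 1)` forces the dimensions to be `1, n, 1`. Hence for `n > 1` there are two layers of total
dimension `n + 1`, or exactly three layers, of dimensions `1, n, 1`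
(`IsUniserialSystem.layerDim_cases`), while for `n = 1` all the layers are lines.

The normal forms come from a choice of coordinates on the layers. A nilpotent Jordan block has
coordinates attached to any cyclic vector (`exists_jordan_coord_of_generator`) and to any functional
that does not vanish on its kernel (`exists_jordan_coord_of_functional`); the cyclic vectors and
functionals used are produced by `B 0`, which leaves no freedom but the parameter matrix `X` or
the vector `a`. The entries `a_i` with `i` even vanish, and `n` is odd, because the `B i` commute.

As for uniqueness, the dimension, the top eigenvalue and the trace of `A` determine `α`, `k`, the number of
layers and `ℓ`, and an isomorphism between two representations of the same shape is so close to a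
scalar that it preserves `X` and `a`. -/

/-! ### Coordinates adapted to a nilpotent operator -/

section NilpotentCoordinates

variable {F W : Type*} [Field F] [AddCommGroup W] [Module F W]

theorem upperJordan_zero_mulVec_apply (q : ℕ) (w : Fin q → F) (i : Fin q) :
    (upperJordan q 0 *ᵥ w) i = if h : i.val + 1 < q then w ⟨i.val + 1, h⟩ else 0 := by
  simp only [Matrix.mulVec, dotProduct, upperJordan, Matrix.of_apply]
  split_ifs with h
  · rw [Finset.sum_eq_single (⟨i.val + 1, h⟩ : Fin q)]
    · simp [Fin.ext_iff]
    · intro b _ hb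
      have : b.val ≠ i.val + 1 := fun h' => hb (Fin.ext h')
      simp [this]
    · simp
  · refine Finset.sum_eq_zero fun b _ => ?_
    have : b.val ≠ i.val + 1 := by omega
    simp [this]

theorem IsNilpotent.pow_finrank_eq_zero [FiniteDimensional F W] {N : Module.End F W}
    (hN : IsNilpotent N) : N ^ Module.finrank F W = 0 := by
  have h := LinearMap.aeval_self_charpoly N
  rwa [hN.charpoly_eq_X_pow_finrank, map_pow, Polynomial.aeval_X] at h

/-- If no nonzero vector of `ker N` is killed by the functional `φ`, then
`u ↦ (φ u, φ (N u), φ (N² u), …)` is a coordinate system in which the nilpotent operator `N` is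
the shift, that is, an upper triangular Jordan block. -/
theorem exists_jordan_coord_of_functional [FiniteDimensional F W] {N : Module.End F W} {q : ℕ}
    (hq : Module.finrank F W = q) (hN : IsNilpotent N) (φ : W →ₗ[F] F)
    (hφ : ∀ u, N u = 0 → φ u = 0 → u = 0) :
    ∃ T : W ≃ₗ[F] (Fin q → F), (∀ u l, T u l = φ ((N ^ l.val) u)) ∧
      ∀ u, T (N u) = upperJordan q 0 *ᵥ T u := by
  have hpow : ∀ u, (N ^ q) u = 0 := by
    intro u
    rw [← hq, hN.pow_finrank_eq_zero, LinearMap.zero_apply]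
  let f : W →ₗ[F] (Fin q → F) := LinearMap.pi fun l => φ ∘ₗ (N ^ l.val)
  have hinj : Function.Injective f := by
    rw [injective_iff_map_eq_zero]
    intro u hu
    have hu' : ∀ l : Fin q, φ ((N ^ l.val) u) = 0 := fun l => congr_fun hu l
    -- `N ^ (q - l) u = 0` for all `l`, descending from `l = 0` to `l = q`
    have key : ∀ l ≤ q, (N ^ (q - l)) u = 0 := by
      intro l
      induction l with
      | zero => exact fun _ => hpow u
      | succ l ih =>
        intro hl
        refine hφ _ ?_ (hu' ⟨q - (l + 1), by omega⟩)
        rw [← Module.End.mul_apply, ← pow_succ', show q - (l + 1) + 1 = q - l by omega]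
        exact ih (by omega)
    simpa using key q le_rfl
  refine ⟨LinearEquiv.ofInjectiveOfFinrankEq f hinj (by simp [hq]), fun u l => rfl, fun u => ?_⟩
  ext i
  rw [upperJordan_zero_mulVec_apply]
  change φ ((N ^ i.val) (N u)) = if h : i.val + 1 < q then φ ((N ^ (i.val + 1)) u) else 0
  rw [← Module.End.mul_apply, ← pow_succ]
  split_ifs with h
  · rfl
  · rw [show i.val + 1 = q by have := i.isLt; omega, hpow, map_zero]

/-- If the nilpotent operator `N` has a cyclic vector `g`, there are coordinates in which `N` is an
upper triangular Jordan block and `g` is the last canonical vector. -/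
theorem exists_jordan_coord_of_generator [FiniteDimensional F W] {N : Module.End F W} {q : ℕ}
    (hq : Module.finrank F W = q) (hN : IsNilpotent N) (g : W) (hg : (N ^ (q - 1)) g ≠ 0) :
    ∃ T : W ≃ₗ[F] (Fin q → F), T g = lastVec F q ∧ ∀ u, T (N u) = upperJordan q 0 *ᵥ T u := by
  have hpow : ∀ k, q ≤ k → ∀ u, (N ^ k) u = 0 := by
    intro k hk u
    rw [pow_eq_zero_of_le hk (by rw [← hq, hN.pow_finrank_eq_zero]), LinearMap.zero_apply]
  have hq0 : 0 < q := by
    rcases Nat.eq_zero_or_pos q with rfl | h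
    · exact absurd (hpow _ le_rfl g) hg
    · exact h
  have hli : LinearIndependent F fun i : Fin q => (N ^ (q - 1 - i.val)) g := by
    classical
    rw [Fintype.linearIndependent_iff]
    intro a ha
    by_contra! hne
    obtain ⟨i₀, hi₀⟩ := hne
    obtain ⟨i, hi, hmax⟩ := (Finset.univ.filter fun i => a i ≠ 0).exists_max_image
      (fun i => i.val) ⟨i₀, by simp [hi₀]⟩
    have h := congrArg (N ^ i.val) ha
    rw [map_sum, map_zero, Finset.sum_eq_single i] at h
    · rw [map_smul, ← Module.End.mul_apply, ← pow_add, show i.val + (q - 1 - i.val) = q - 1 by omega]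
        at h
      simp only [Finset.mem_filter, Finset.mem_univ, true_and] at hi
      exact (smul_ne_zero hi hg) h
    · intro b _ hb
      by_cases hab : a b = 0
      · simp [hab]
      · have hbi := hmax b (by simp [hab])
        have : b.val ≠ i.val := fun h' => hb (Fin.ext h')
        rw [map_smul, ← Module.End.mul_apply, ← pow_add, hpow _ (by omega), smul_zero]
    · simp
  have : Nonempty (Fin q) := ⟨⟨0, hq0⟩⟩
  let b := basisOfLinearIndependentOfCardEqFinrank hli (by simp [hq])
  have hb : ∀ i : Fin q, b i = (N ^ (q - 1 - i.val)) g := fun i => by simp [b]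
  have hbT : ∀ i, b.equivFun (b i) = Pi.single i 1 := by
    intro i
    ext j
    simp [Pi.single_apply, eq_comm]
  refine ⟨b.equivFun, ?_, fun u => ?_⟩
  · have : g = b ⟨q - 1, by omega⟩ := by simp [hb]
    rw [this, hbT]
    ext i
    simp only [lastVec, Pi.single_apply, Fin.ext_iff]
    congr 1
    apply propext
    omega
  · have key : b.equivFun.toLinearMap ∘ₗ N =
        (upperJordan q (0 : F)).mulVecLin ∘ₗ b.equivFun.toLinearMap := by
      refine b.ext fun i => ?_
      simp only [LinearMap.comp_apply, LinearEquiv.coe_coe, Matrix.mulVecLin_apply, hbT]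
      have hN : N (b i) = (N ^ (q - 1 - i.val + 1)) g := by
        rw [hb, ← Module.End.mul_apply, ← pow_succ']
      ext j
      rw [upperJordan_zero_mulVec_apply, hN]
      rcases Nat.eq_zero_or_pos i.val with h0 | h0
      · rw [hpow _ (by omega), map_zero]
        split_ifs with h
        · rw [Pi.single_apply, if_neg]
          · rfl
          · simp [Fin.ext_iff]; omega
        · rfl
      · rw [show (N ^ (q - 1 - i.val + 1)) g = b ⟨i.val - 1, by omega⟩ by
          rw [hb]; congr 2; simp; omega, hbT]
        split_ifs with h
        · simp only [Pi.single_apply, Fin.ext_iff]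
          congr 1
          apply propext
          omega
        · rw [Pi.single_apply, if_neg]
          simp only [Fin.ext_iff]
          omega
    exact LinearMap.congr_fun key u

/-- A nilpotent operator whose kernel is a line has one Jordan block: the kernel of its
`(dim W - 1)`-th power is its range. -/
theorem mem_range_of_pow_apply_eq_zero [FiniteDimensional F W] {N : Module.End F W}
    (hN : IsNilpotent N)
    (hker : ∀ u u', N u = 0 → N u' = 0 → u ≠ 0 → ∃ t : F, u' = t • u)
    {x : W} (hx : (N ^ (Module.finrank F W - 1)) x = 0) : ∃ y, N y = x := by
  by_cases hx0 : x = 0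
  · exact ⟨0, by simp [hx0]⟩
  have hpos : 0 < Module.finrank F W := by
    have : Nontrivial W := ⟨⟨x, 0, hx0⟩⟩
    exact Module.finrank_pos
  obtain ⟨e, he0, hNe⟩ : ∃ e, e ≠ 0 ∧ N e = 0 := by
    by_contra! h
    have hinj : Function.Injective N := by
      rw [injective_iff_map_eq_zero]
      intro u hu
      by_contra hu0
      exact h u hu0 hu
    obtain ⟨k, hk⟩ := hN
    have := (Module.End.coe_pow N k ▸ hinj.iterate k : Function.Injective (N ^ k))
    exact hx0 (this (by simp [hk]))
  obtain ⟨φ, hφ⟩ : ∃ φ : W →ₗ[F] F, φ e ≠ 0 := by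
    by_contra! h
    exact he0 ((Module.forall_dual_apply_eq_zero_iff F e).mp h)
  obtain ⟨T, hT, hTN⟩ := exists_jordan_coord_of_functional rfl hN φ (by
    intro u hu hφu
    obtain ⟨t, rfl⟩ := hker e u hNe hu he0
    rw [map_smul, smul_eq_mul, mul_eq_zero] at hφu
    rcases hφu with rfl | h
    · simp
    · exact absurd h hφ)
  refine ⟨T.symm fun i => if h : 0 < i.val then T x ⟨i.val - 1, by omega⟩ else 0, ?_⟩
  apply T.injective
  rw [hTN, LinearEquiv.apply_symm_apply]
  ext i
  rw [upperJordan_zero_mulVec_apply]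
  by_cases h : i.val + 1 < Module.finrank F W
  · simp [h]
  · have : i.val = Module.finrank F W - 1 := by have := i.isLt; omega
    rw [dif_neg h, hT, this, hx, map_zero]

end NilpotentCoordinates

/-! ### Operator systems and their layers -/

section Layers

variable {F U : Type*} [Field F] [AddCommGroup U] [Module F U]

/-- The operators through which a uniserial representation of `⟨x⟩ ⋉ V` acts: `A` stands for the
image of `x`, and `B i` for the image of `v_i` (with `B i = 0` for `i ≥ n`, so that the relation
`[x, v_i] = c v_i + v_{i+1}` needs no case distinction). -/
structure IsUniserialSystem (n : ℕ) (c : F) (A : Module.End F U) (B : ℕ → Module.End F U) :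
    Prop where
  lie : ∀ i, A * B i - B i * A = c • B i + B (i + 1)
  comm : ∀ i j, B i * B j = B j * B i
  vanish : ∀ i, n ≤ i → B i = 0
  chain : ∀ W W' : Submodule F U, (∀ u ∈ W, A u ∈ W) → (∀ i, ∀ u ∈ W, B i u ∈ W) →
    (∀ u ∈ W', A u ∈ W') → (∀ i, ∀ u ∈ W', B i u ∈ W') → W ≤ W' ∨ W' ≤ W

/-- The operator `A - (α - j c)`, nilpotent on the `j`-th layer. -/
def layerShift (A : Module.End F U) (α c : F) (j : ℕ) : Module.End F U :=
  A - (α - j * c) • 1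

/-- The generalized eigenspace of `A` for the eigenvalue `α - j c`. -/
def layer (A : Module.End F U) (α c : F) (j : ℕ) : Submodule F U :=
  A.maxGenEigenspace (α - j * c)

/-- The sum of the layers of index less than `j`. -/
def below (A : Module.End F U) (α c : F) (j : ℕ) : Submodule F U :=
  ⨆ i ∈ Set.Iio j, layer A α c i

variable {n : ℕ} {α c : F} {A : Module.End F U} {B : ℕ → Module.End F U}

theorem layerShift_apply (j : ℕ) (u : U) : layerShift A α c j u = A u - (α - j * c) • u := by
  simp [layerShift]

theorem mem_layer {j : ℕ} {u : U} : u ∈ layer A α c j ↔ ∃ k, (layerShift A α c j ^ k) u = 0 := by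
  rw [layer, Module.End.mem_maxGenEigenspace]
  rfl

theorem layerShift_mem_layer {j : ℕ} {u : U} (hu : u ∈ layer A α c j) :
    layerShift A α c j u ∈ layer A α c j := by
  obtain ⟨k, hk⟩ := mem_layer.mp hu
  refine mem_layer.mpr ⟨k, ?_⟩
  rw [← Module.End.mul_apply, ← pow_succ, pow_succ', Module.End.mul_apply, hk, map_zero]

theorem layerShift_pow_mem_layer {j : ℕ} {u : U} (hu : u ∈ layer A α c j) (k : ℕ) :
    (layerShift A α c j ^ k) u ∈ layer A α c j := by
  induction k with
  | zero => simpa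
  | succ k ih =>
    rw [pow_succ', Module.End.mul_apply]
    exact layerShift_mem_layer ih

theorem apply_mem_of_layerShift_mem {j : ℕ} {P : Submodule F U}
    (hP : ∀ u ∈ P, layerShift A α c j u ∈ P) {u : U} (hu : u ∈ P) : A u ∈ P := by
  have h := P.add_mem (hP u hu) (P.smul_mem (α - j * c) hu)
  rwa [layerShift_apply, sub_add_cancel] at h

theorem apply_mem_layer {j : ℕ} {u : U} (hu : u ∈ layer A α c j) : A u ∈ layer A α c j :=
  apply_mem_of_layerShift_mem (fun _ => layerShift_mem_layer) hu

theorem layer_injective [CharZero F] (hc : c ≠ 0) :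
    Function.Injective fun j : ℕ => α - j * c := by
  intro i j h
  simpa [hc] using h

theorem iSupIndep_layer [CharZero F] (hc : c ≠ 0) : iSupIndep (layer A α c) :=
  A.independent_maxGenEigenspace.comp (layer_injective hc)

theorem disjoint_layer_below [CharZero F] (hc : c ≠ 0) {j k : ℕ} (hkj : k ≤ j) :
    Disjoint (layer A α c j) (below A α c k) :=
  (iSupIndep_layer hc).disjoint_biSup (by simpa using hkj)

theorem layer_le_below {i j : ℕ} (h : i < j) : layer A α c i ≤ below A α c j :=
  le_iSup₂_of_le i h le_rfl

theorem below_mono {i j : ℕ} (h : i ≤ j) : below A α c i ≤ below A α c j :=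
  biSup_mono fun _ hk => lt_of_lt_of_le hk h

theorem below_zero : below A α c 0 = ⊥ := by simp [below]

theorem below_succ (j : ℕ) : below A α c (j + 1) = layer A α c j ⊔ below A α c j := by
  apply le_antisymm
  · refine iSup₂_le fun i hi => ?_
    rcases Nat.lt_succ_iff_lt_or_eq.mp hi with h | rfl
    · exact (layer_le_below h).trans le_sup_right
    · exact le_sup_left
  · exact sup_le (layer_le_below j.lt_succ_self) (below_mono j.le_succ)

theorem below_le_of_invariant {f : Module.End F U} {W : Submodule F U} {j : ℕ}
    (h : ∀ i < j, ∀ u ∈ layer A α c i, f u ∈ W) {u : U} (hu : u ∈ below A α c j) : f u ∈ W := by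
  have : below A α c j ≤ W.comap f := iSup₂_le fun i hi u hu => h i hi u hu
  exact this hu

theorem apply_mem_below {j : ℕ} {u : U} (hu : u ∈ below A α c j) : A u ∈ below A α c j :=
  below_le_of_invariant (fun _ hi _ hu => layer_le_below hi (apply_mem_layer hu)) hu

namespace IsUniserialSystem

variable (h : IsUniserialSystem n c A B)
include h

theorem layerShift_mul_sub (i j : ℕ) :
    layerShift A α c j * B i - B i * layerShift A α c (j + 1) = B (i + 1) := by
  have h1 := h.lie i
  rw [sub_eq_iff_eq_add] at h1
  simp only [layerShift, sub_mul, mul_sub, h1, smul_mul_assoc, mul_smul_comm, one_mul, mul_one,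
    Nat.cast_add, Nat.cast_one]
  module

theorem layerShift_apply_B (i j : ℕ) (u : U) :
    layerShift A α c j (B i u) = B i (layerShift A α c (j + 1) u) + B (i + 1) u := by
  have := LinearMap.congr_fun (h.layerShift_mul_sub (α := α) i j) u
  simp only [LinearMap.sub_apply, Module.End.mul_apply] at this
  rw [← this]
  abel

theorem B_mem_maxGenEigenspace {μ : F} (i : ℕ) {u : U} (hu : u ∈ A.maxGenEigenspace μ) :
    B i u ∈ A.maxGenEigenspace (μ + c) := by
  rw [Module.End.mem_maxGenEigenspace] at hu ⊢
  obtain ⟨a, ha⟩ := hu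
  -- Each application of `A - (μ + c)` either lowers the nilpotency order of `u` or raises `i`.
  have key : ∀ s a b i, a + b ≤ s → n ≤ i + b → ∀ u, ((A - μ • 1) ^ a) u = 0 →
      ((A - (μ + c) • 1) ^ s) (B i u) = 0 := by
    intro s
    induction s with
    | zero =>
      intro a b i hs hb u hu
      obtain rfl : a = 0 := by omega
      have : u = 0 := by simpa using hu
      simp [this]
    | succ s ih =>
      intro a b i hs hb u hu
      have h1 := LinearMap.congr_fun (h.lie i) u
      simp only [LinearMap.sub_apply, Module.End.mul_apply, LinearMap.add_apply,
        LinearMap.smul_apply] at h1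
      have h2 : (A - (μ + c) • 1) (B i u) = B i ((A - μ • 1) u) + B (i + 1) u := by
        rw [sub_eq_iff_eq_add] at h1
        simp only [LinearMap.sub_apply, LinearMap.smul_apply, Module.End.one_apply, h1, map_sub,
          map_smul]
        module
      rw [pow_succ, Module.End.mul_apply, h2, map_add]
      have e1 : ((A - (μ + c) • 1) ^ s) (B i ((A - μ • 1) u)) = 0 := by
        rcases Nat.eq_zero_or_pos a with rfl | ha
        · have : u = 0 := by simpa using hu
          simp [this]
        · refine ih (a - 1) b i (by omega) hb _ ?_
          rw [← Module.End.mul_apply, ← pow_succ, Nat.sub_add_cancel ha, hu]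
      have e2 : ((A - (μ + c) • 1) ^ s) (B (i + 1) u) = 0 := by
        rcases Nat.eq_zero_or_pos b with rfl | hb0
        · rw [h.vanish (i + 1) (by omega), LinearMap.zero_apply, map_zero]
        · exact ih a (b - 1) (i + 1) (by omega) (by omega) u hu
      rw [e1, e2, add_zero]
  exact ⟨a + n, key (a + n) a n i le_rfl (by omega) u ha⟩

theorem B_mem_layer {i j : ℕ} {u : U} (hu : u ∈ layer A α c (j + 1)) : B i u ∈ layer A α c j := by
  have := h.B_mem_maxGenEigenspace i hu
  rwa [show α - ((j + 1 : ℕ) : F) * c + c = α - j * c by push_cast; ring] at this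

end IsUniserialSystem

/-- `A` has a top eigenvalue `α` and all its eigenvalues are `α, α - c, …, α - m c`. -/
structure HasLayers (A : Module.End F U) (α c : F) (m : ℕ) : Prop where
  top_eq_bot : A.maxGenEigenspace (α + c) = ⊥
  ne_bot : ∀ j ≤ m, layer A α c j ≠ ⊥
  below_eq_top : below A α c (m + 1) = ⊤

/-- Starting in a finite subset of a field of characteristic zero, one leaves the set by adding a
nonzero element repeatedly. -/
theorem exists_last_mem_add_nsmul [CharZero F] {S : Set F} (hS : S.Finite) {μ d : F} (hμ : μ ∈ S)
    (hd : d ≠ 0) : ∃ m : ℕ, (∀ j ≤ m, μ + j * d ∈ S) ∧ μ + (m + 1 : ℕ) * d ∉ S := by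
  classical
  have hex : ∃ k : ℕ, μ + k * d ∉ S := by
    by_contra! hall
    refine Set.infinite_of_injective_forall_mem (f := fun k : ℕ => μ + k * d) ?_ hall hS
    intro i j hij
    simpa [hd] using hij
  have h0 : Nat.find hex ≠ 0 := by
    intro h0
    have := Nat.find_spec hex
    rw [h0] at this
    simp [hμ] at this
  refine ⟨Nat.find hex - 1, fun j hj => ?_, ?_⟩
  · by_contra hn
    have := Nat.find_min' hex hn
    omega
  · rw [Nat.sub_add_cancel (Nat.pos_of_ne_zero h0)]
    exact Nat.find_spec hex

namespace IsUniserialSystem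

/-- The eigenvalues of `A` form an arithmetic progression: if `α, α - c, …, α - m c` is a maximal
run of eigenvalues, the corresponding layers and the remaining generalized eigenspaces span two
invariant subspaces with zero intersection, so the latter vanishes. -/
theorem exists_hasLayers [IsAlgClosed F] [CharZero F] [FiniteDimensional F U] [Nontrivial U]
    (h : IsUniserialSystem n c A B) (hc : c ≠ 0) : ∃ α m, HasLayers A α c m := by
  have hfin : {μ : F | A.HasEigenvalue μ}.Finite := Module.End.finite_hasEigenvalue A
  have hbot : ∀ μ, ¬ A.HasEigenvalue μ → A.maxGenEigenspace μ = ⊥ := by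
    intro μ hμ
    by_contra hne
    apply hμ
    exact Module.End.HasUnifEigenvalue.lt (k := ⊤) zero_lt_one hne
  have hnebot : ∀ μ, A.HasEigenvalue μ → A.maxGenEigenspace μ ≠ ⊥ := by
    intro μ hμ hb
    exact hμ (eq_bot_iff.mpr (hb ▸ Module.End.eigenspace_le_maxGenEigenspace))
  obtain ⟨μ, hμ⟩ := Module.End.exists_eigenvalue A
  obtain ⟨k, hk, hk'⟩ := exists_last_mem_add_nsmul hfin hμ hc
  set α := μ + k * c with hα
  obtain ⟨m, hm, hm'⟩ := exists_last_mem_add_nsmul hfin (hk k le_rfl) (neg_ne_zero.mpr hc)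
  have heq : ∀ j : ℕ, α + j * -c = α - j * c := fun j => by ring
  have htop : A.maxGenEigenspace (α + c) = ⊥ := by
    apply hbot
    rwa [Set.mem_ofPred_eq, show μ + ((k + 1 : ℕ) : F) * c = α + c by rw [hα]; push_cast; ring] at hk'
  have hne : ∀ j ≤ m, layer A α c j ≠ ⊥ := fun j hj =>
    hnebot _ (by have := hm j hj; rwa [Set.mem_ofPred_eq, ← hα, heq] at this)
  have hlast : A.maxGenEigenspace (α - ((m + 1 : ℕ) : F) * c) = ⊥ := by
    apply hbot
    rwa [Set.mem_ofPred_eq, ← hα, heq] at hm'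
  refine ⟨α, m, htop, hne, ?_⟩
  let S : Set F := (fun j : ℕ => α - j * c) '' Set.Iio (m + 1)
  let W' : Submodule F U := ⨆ μ ∈ Sᶜ, A.maxGenEigenspace μ
  have hbelow : below A α c (m + 1) = ⨆ μ ∈ S, A.maxGenEigenspace μ := by
    simp only [below, layer, S, iSup_image]
  have hsup : below A α c (m + 1) ⊔ W' = ⊤ := by
    rw [eq_top_iff, ← Module.End.iSup_maxGenEigenspace_eq_top A, hbelow]
    refine iSup_le fun μ => ?_
    by_cases hμS : μ ∈ S
    · exact (le_iSup₂_of_le (f := fun μ (_ : μ ∈ S) => A.maxGenEigenspace μ) μ hμS le_rfl).trans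
        le_sup_left
    · exact (le_iSup₂_of_le (f := fun μ (_ : μ ∈ Sᶜ) => A.maxGenEigenspace μ) μ hμS le_rfl).trans
        le_sup_right
  have hdisj : Disjoint (below A α c (m + 1)) W' := by
    rw [hbelow]
    exact A.independent_maxGenEigenspace.disjoint_biSup_biSup disjoint_compl_right
  have hinv : ∀ (f : Module.End F U), (∀ μ ∉ S, ∀ u ∈ A.maxGenEigenspace μ, f u ∈ W') →
      ∀ u ∈ W', f u ∈ W' := by
    intro f hf u hu
    have : W' ≤ W'.comap f := iSup₂_le fun μ hμ u hu => hf μ hμ u hu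
    exact this hu
  have hchain : below A α c (m + 1) ≤ W' ∨ W' ≤ below A α c (m + 1) := by
    refine h.chain _ _ (fun u hu => apply_mem_below hu) ?_ ?_ ?_
    · intro i u hu
      refine below_le_of_invariant (fun j hj w hw => ?_) hu
      rcases j with _ | j
      · have := h.B_mem_maxGenEigenspace i hw
        rw [show α - ((0 : ℕ) : F) * c + c = α + c by push_cast; ring, htop,
          Submodule.mem_bot] at this
        rw [this]
        exact zero_mem _
      · exact layer_le_below (by omega) (h.B_mem_layer hw)
    · refine hinv A fun μ hμ u hu => ?_
      exact (le_iSup₂_of_le (f := fun μ (_ : μ ∈ Sᶜ) => A.maxGenEigenspace μ) μ hμ le_rfl)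
        (Module.End.mapsTo_maxGenEigenspace_of_comm (Commute.refl A) μ hu)
    · intro i
      refine hinv (B i) fun μ hμ u hu => ?_
      have hBu := h.B_mem_maxGenEigenspace i hu
      by_cases hμc : μ + c ∈ S
      · obtain ⟨j, hj, hjμ⟩ := hμc
        simp only [Set.mem_Iio] at hj
        have hμ' : μ = α - ((j + 1 : ℕ) : F) * c := by
          simp only at hjμ
          push_cast
          linear_combination hjμ.symm
        have : ¬ j + 1 < m + 1 := fun hlt => hμ ⟨j + 1, hlt, hμ'.symm⟩
        obtain rfl : j = m := by omega
        rw [hμ', hlast, Submodule.mem_bot] at hu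
        simp [hu]
      · exact (le_iSup₂_of_le (f := fun μ (_ : μ ∈ Sᶜ) => A.maxGenEigenspace μ) (μ + c) hμc le_rfl)
          hBu
  rcases hchain with hle | hle
  · have hb : below A α c (m + 1) = ⊥ := disjoint_self.mp (hdisj.mono_right hle)
    exact absurd (eq_bot_iff.mpr (hb ▸ layer_le_below (Nat.succ_pos m))) (hne 0 (Nat.zero_le m))
  · rw [← hsup]
    exact (sup_eq_left.mpr hle).symm

end IsUniserialSystem

end Layers

/-! ### The layers are Jordan blocks -/

section LayerStructure

variable {F U : Type*} [Field F] [AddCommGroup U] [Module F U]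
variable {n m : ℕ} {α c : F} {A : Module.End F U} {B : ℕ → Module.End F U}

/-- The dimension of the `j`-th layer. -/
noncomputable def layerDim (A : Module.End F U) (α c : F) (j : ℕ) : ℕ :=
  Module.finrank F (layer A α c j)

/-- The operator `A - (α - j c)` on the `j`-th layer. -/
def layerNil (A : Module.End F U) (α c : F) (j : ℕ) : Module.End F (layer A α c j) :=
  (layerShift A α c j).restrict fun _ => layerShift_mem_layer

theorem coe_layerNil (j : ℕ) (u : layer A α c j) :
    (layerNil A α c j u : U) = layerShift A α c j u := rfl

theorem coe_layerNil_pow (j k : ℕ) (u : layer A α c j) :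
    ((layerNil A α c j ^ k) u : U) = (layerShift A α c j ^ k) u := by
  induction k generalizing u with
  | zero => simp
  | succ k ih => rw [pow_succ, pow_succ, Module.End.mul_apply, Module.End.mul_apply, ih, coe_layerNil]

theorem isNilpotent_layerNil [FiniteDimensional F U] (j : ℕ) :
    IsNilpotent (layerNil A α c j) := by
  have := Module.End.isNilpotent_restrict_maxGenEigenspace_sub_algebraMap A (α - j * c)
  exact this

theorem layerShift_pow_layerDim [FiniteDimensional F U] {j k : ℕ} (hk : layerDim A α c j ≤ k)
    {u : U} (hu : u ∈ layer A α c j) : (layerShift A α c j ^ k) u = 0 := by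
  have h : layerNil A α c j ^ k = 0 :=
    pow_eq_zero_of_le hk (isNilpotent_layerNil j).pow_finrank_eq_zero
  have h' := coe_layerNil_pow j k ⟨u, hu⟩
  rw [h] at h'
  exact h'.symm

theorem eq_bot_of_layerShift_surjOn [FiniteDimensional F U] {j : ℕ}
    (hs : ∀ u ∈ layer A α c j, ∃ w ∈ layer A α c j, layerShift A α c j w = u) :
    layer A α c j = ⊥ := by
  have hsur : Function.Surjective (layerNil A α c j) := by
    rintro ⟨u, hu⟩
    obtain ⟨w, hw, hwu⟩ := hs u hu
    exact ⟨⟨w, hw⟩, Subtype.ext hwu⟩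
  obtain ⟨k, hk⟩ := isNilpotent_layerNil (A := A) (α := α) (c := c) j
  have hsurk : Function.Surjective (layerNil A α c j ^ k) := by
    rw [Module.End.coe_pow]
    exact hsur.iterate k
  rw [eq_bot_iff]
  intro u hu
  obtain ⟨w, hw⟩ := hsurk ⟨u, hu⟩
  rw [hk] at hw
  exact (congrArg Subtype.val hw).symm

namespace IsUniserialSystem

variable (h : IsUniserialSystem n c A B)
include h

theorem B_apply_layer_zero (hL : HasLayers A α c m) {i : ℕ} {u : U} (hu : u ∈ layer A α c 0) :
    B i u = 0 := by
  have := h.B_mem_maxGenEigenspace i hu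
  rwa [show α - ((0 : ℕ) : F) * c + c = α + c by push_cast; ring, hL.top_eq_bot,
    Submodule.mem_bot] at this

theorem B_mem_below_of_mem_layer (hL : HasLayers A α c m) {i j : ℕ} {u : U}
    (hu : u ∈ layer A α c j) : B i u ∈ below A α c j := by
  rcases j with _ | j
  · rw [h.B_apply_layer_zero hL hu]
    exact zero_mem _
  · exact layer_le_below j.lt_succ_self (h.B_mem_layer hu)

theorem B_mem_below (hL : HasLayers A α c m) {i j : ℕ} {u : U} (hu : u ∈ below A α c j) :
    B i u ∈ below A α c j :=
  below_le_of_invariant (fun _ hj _ hw => below_mono hj.le (h.B_mem_below_of_mem_layer hL hw)) hu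

/-- Subspaces of a layer that are invariant under `A` form a chain: add all the layers of
smaller index. -/
theorem chain_of_le_layer [CharZero F] (hc : c ≠ 0) (hL : HasLayers A α c m) {j : ℕ}
    {P P' : Submodule F U} (hP : P ≤ layer A α c j) (hP' : P' ≤ layer A α c j)
    (hAP : ∀ u ∈ P, A u ∈ P) (hAP' : ∀ u ∈ P', A u ∈ P') : P ≤ P' ∨ P' ≤ P := by
  have hA : ∀ Q : Submodule F U, (∀ u ∈ Q, A u ∈ Q) →
      ∀ u ∈ Q ⊔ below A α c j, A u ∈ Q ⊔ below A α c j := by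
    intro Q hQ u hu
    obtain ⟨q, hq, w, hw, rfl⟩ := Submodule.mem_sup.mp hu
    rw [map_add]
    exact Submodule.add_mem_sup (hQ q hq) (apply_mem_below hw)
  have hB : ∀ Q : Submodule F U, Q ≤ layer A α c j →
      ∀ i, ∀ u ∈ Q ⊔ below A α c j, B i u ∈ Q ⊔ below A α c j := by
    intro Q hQ i u hu
    obtain ⟨q, hq, w, hw, rfl⟩ := Submodule.mem_sup.mp hu
    rw [map_add]
    refine Submodule.mem_sup_right (add_mem ?_ (h.B_mem_below hL hw))
    exact h.B_mem_below_of_mem_layer hL (hQ hq)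
  have hle : ∀ Q Q' : Submodule F U, Q ≤ layer A α c j → Q' ≤ layer A α c j →
      Q ⊔ below A α c j ≤ Q' ⊔ below A α c j → Q ≤ Q' := by
    intro Q Q' hQ hQ' hQQ u hu
    obtain ⟨q, hq, w, hw, hqw⟩ := Submodule.mem_sup.mp (hQQ (Submodule.mem_sup_left hu))
    have hw' : w ∈ layer A α c j := by
      rw [show w = u - q by rw [← hqw]; abel]
      exact sub_mem (hQ hu) (hQ' hq)
    have hw0 : w = 0 :=
      Submodule.disjoint_def.mp (disjoint_layer_below hc le_rfl) w hw' hw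
    rw [← hqw, hw0, add_zero]
    exact hq
  exact (h.chain _ _ (hA P hAP) (hB P hP) (hA P' hAP') (hB P' hP')).imp
    (hle P P' hP hP') (hle P' P hP' hP)

/-- On each layer the kernel of `A - (α - j c)` is at most a line. -/
theorem exists_smul_eq_of_layerShift_eq_zero [CharZero F] (hc : c ≠ 0) (hL : HasLayers A α c m)
    {j : ℕ} {u u' : U} (hu : u ∈ layer A α c j) (hu' : u' ∈ layer A α c j)
    (h0 : layerShift A α c j u = 0) (h0' : layerShift A α c j u' = 0) (hne : u ≠ 0) :
    ∃ t : F, u' = t • u := by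
  have hinv : ∀ w : U, layerShift A α c j w = 0 →
      ∀ z ∈ Submodule.span F {w}, A z ∈ Submodule.span F {w} := by
    intro w hw
    have hw' : A w = (α - j * c) • w := by rwa [layerShift_apply, sub_eq_zero] at hw
    intro z hz
    obtain ⟨t, rfl⟩ := Submodule.mem_span_singleton.mp hz
    rw [map_smul, hw']
    exact Submodule.smul_mem _ _ (Submodule.smul_mem _ _ (Submodule.mem_span_singleton_self w))
  have hle : ∀ w ∈ layer A α c j, Submodule.span F {w} ≤ layer A α c j := fun w hw =>
    (Submodule.span_singleton_le_iff_mem _ _).mpr hw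
  rcases h.chain_of_le_layer hc hL (hle u hu) (hle u' hu') (hinv u h0) (hinv u' h0') with hs | hs
  · obtain ⟨t, ht⟩ := Submodule.mem_span_singleton.mp (hs (Submodule.mem_span_singleton_self u))
    have ht0 : t ≠ 0 := by
      rintro rfl
      exact hne (by rw [← ht, zero_smul])
    exact ⟨t⁻¹, by rw [← ht, smul_smul, inv_mul_cancel₀ ht0, one_smul]⟩
  · obtain ⟨t, ht⟩ := Submodule.mem_span_singleton.mp (hs (Submodule.mem_span_singleton_self u'))
    exact ⟨t, ht.symm⟩

theorem exists_layerShift_eq [CharZero F] [FiniteDimensional F U] (hc : c ≠ 0)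
    (hL : HasLayers A α c m) {j : ℕ} {u : U} (hu : u ∈ layer A α c j)
    (h0 : (layerShift A α c j ^ (layerDim A α c j - 1)) u = 0) :
    ∃ w ∈ layer A α c j, layerShift A α c j w = u := by
  obtain ⟨w, hw⟩ := mem_range_of_pow_apply_eq_zero (isNilpotent_layerNil (A := A) (α := α) (c := c) j)
    (fun a b ha hb hne => by
      obtain ⟨t, ht⟩ := h.exists_smul_eq_of_layerShift_eq_zero hc hL a.2 b.2
        (by rw [← coe_layerNil, ha]; rfl) (by rw [← coe_layerNil, hb]; rfl)
        (by simpa using hne)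
      exact ⟨t, Subtype.ext ht⟩)
    (x := ⟨u, hu⟩) (Subtype.ext (by rw [coe_layerNil_pow]; exact h0))
  exact ⟨w, w.2, by rw [← coe_layerNil, hw]⟩

theorem exists_generator [CharZero F] [FiniteDimensional F U] (hc : c ≠ 0)
    (hL : HasLayers A α c m) {j : ℕ} (hj : j ≤ m) :
    ∃ g ∈ layer A α c j, (layerShift A α c j ^ (layerDim A α c j - 1)) g ≠ 0 := by
  by_contra! hg
  exact hL.ne_bot j hj (eq_bot_of_layerShift_surjOn fun u hu =>
    h.exists_layerShift_eq hc hL hu (hg u hu))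

/-- A uniserial system cannot be split between two consecutive layers: the image under `B 0` of an
eigenvector in the layer `j + 1` is a cyclic vector of the layer `j`. -/
theorem layerShift_pow_B_ne_zero [CharZero F] [FiniteDimensional F U] (hc : c ≠ 0)
    (hL : HasLayers A α c m) {j : ℕ} (hj : j + 1 ≤ m) {e : U} (he : e ∈ layer A α c (j + 1))
    (h0 : layerShift A α c (j + 1) e = 0) (hne : e ≠ 0) :
    (layerShift A α c j ^ (layerDim A α c j - 1)) (B 0 e) ≠ 0 := by
  intro hzero
  obtain ⟨w, hw, hwe⟩ := h.exists_layerShift_eq hc hL (h.B_mem_layer he) hzero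
  -- Otherwise `e`, the image of `A - (α - j c)` on layer `j`, and the layers of smaller index span
  -- an invariant subspace which is not comparable with the sum of the layers up to `j`.
  let Q : Submodule F U := (layer A α c j).map (layerShift A α c j)
  have hQ : Q ≤ layer A α c j := by
    rintro _ ⟨u, hu, rfl⟩
    exact layerShift_mem_layer hu
  have hAQ : ∀ u ∈ Q, A u ∈ Q := fun u hu =>
    apply_mem_of_layerShift_mem (α := α) (c := c) (j := j) (P := Q) (fun w hw => ⟨w, hQ hw, rfl⟩) hu
  have hAe : A e = (α - (j + 1 : ℕ) * c) • e := by rwa [layerShift_apply, sub_eq_zero] at h0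
  have hBe : ∀ i, B i e ∈ Q := by
    intro i
    rcases i with _ | i
    · exact ⟨w, hw, hwe⟩
    · refine ⟨B i e, h.B_mem_layer he, ?_⟩
      rw [h.layerShift_apply_B, h0, map_zero, zero_add]
  let W : Submodule F U := Submodule.span F {e} ⊔ (Q ⊔ below A α c j)
  have hW : ∀ u ∈ W, ∃ t : F, ∃ y ∈ layer A α c j, ∃ z ∈ below A α c j,
      u = t • e + (layerShift A α c j y + z) := by
    intro u hu
    obtain ⟨a, ha, b, hb, rfl⟩ := Submodule.mem_sup.mp hu
    obtain ⟨t, rfl⟩ := Submodule.mem_span_singleton.mp ha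
    obtain ⟨_, ⟨y, hy, rfl⟩, z, hz, rfl⟩ := Submodule.mem_sup.mp hb
    exact ⟨t, y, hy, z, hz, rfl⟩
  have hQW : Q ⊔ below A α c j ≤ W := le_sup_right
  have hch := h.chain W (below A α c (j + 1))
    (by
      intro u hu
      obtain ⟨t, y, hy, z, hz, rfl⟩ := hW u hu
      rw [map_add, map_add, map_smul, hAe]
      refine Submodule.add_mem_sup (Submodule.smul_mem _ _ (Submodule.smul_mem _ _
        (Submodule.mem_span_singleton_self e))) (Submodule.add_mem_sup (hAQ _ ⟨y, hy, rfl⟩)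
          (apply_mem_below hz)))
    (by
      intro i u hu
      obtain ⟨t, y, hy, z, hz, rfl⟩ := hW u hu
      rw [map_add, map_add, map_smul]
      refine hQW (add_mem (Submodule.mem_sup_left (Submodule.smul_mem _ _ (hBe i)))
        (Submodule.mem_sup_right (add_mem ?_ (h.B_mem_below hL hz))))
      exact h.B_mem_below_of_mem_layer hL (layerShift_mem_layer hy))
    (fun u hu => apply_mem_below hu) (fun i u hu => h.B_mem_below hL hu)
  have hdisj := Submodule.disjoint_def.mp
    (disjoint_layer_below (A := A) (α := α) hc (le_refl (j + 1)))
  rcases hch with hle | hle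
  · exact hne (hdisj e he (hle (Submodule.mem_sup_left (Submodule.mem_span_singleton_self e))))
  · refine hL.ne_bot j (by omega) (eq_bot_of_layerShift_surjOn fun u hu => ?_)
    obtain ⟨t, y, hy, z, hz, hu'⟩ := hW u (hle (layer_le_below j.lt_succ_self hu))
    have hzb : z ∈ below A α c (j + 1) := below_mono j.le_succ hz
    have hyl := layerShift_mem_layer hy
    have hte : t • e = 0 := by
      refine hdisj _ (Submodule.smul_mem _ _ he) ?_
      rw [show t • e = u - (layerShift A α c j y + z) by rw [hu']; abel]
      exact sub_mem (layer_le_below j.lt_succ_self hu)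
        (add_mem (layer_le_below j.lt_succ_self hyl) hzb)
    rw [hte, zero_add] at hu'
    have hz0 : z = 0 := by
      refine Submodule.disjoint_def.mp (disjoint_layer_below (A := A) (α := α) hc (le_refl j)) z ?_ hz
      rw [show z = u - layerShift A α c j y by rw [hu']; abel]
      exact sub_mem hu hyl
    exact ⟨y, hy, by rw [hu', hz0, add_zero]⟩

/-- The operators `B k` are obtained from `B 0` by a binomial formula. -/
theorem B_eq_sum (k j : ℕ) : B k = ∑ l ∈ Finset.range (k + 1),
    ((-1) ^ (k - l) * (k.choose l : F)) •
      (layerShift A α c j ^ l * B 0 * layerShift A α c (j + 1) ^ (k - l)) := by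
  set f := layerShift A α c j
  set g := layerShift A α c (j + 1)
  have h1 : ((LinearMap.mulLeft F f + -LinearMap.mulRight F g) ^ k) (B 0) = B k := by
    induction k with
    | zero => simp
    | succ k ih =>
      rw [pow_succ', Module.End.mul_apply, ih, LinearMap.add_apply, LinearMap.neg_apply,
        LinearMap.mulLeft_apply, LinearMap.mulRight_apply, ← sub_eq_add_neg]
      exact h.layerShift_mul_sub k j
  have hcomm : Commute (LinearMap.mulLeft F f) (-LinearMap.mulRight F g) :=
    (LinearMap.commute_mulLeft_right (R := F) f g).neg_right
  rw [← h1, hcomm.add_pow, LinearMap.sum_apply]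
  refine Finset.sum_congr rfl fun l _ => ?_
  rw [← Nat.cast_comm, ← nsmul_eq_mul, LinearMap.smul_apply, Module.End.mul_apply,
    LinearMap.pow_mulLeft, neg_pow (LinearMap.mulRight F g : Module.End F _),
    LinearMap.pow_mulRight]
  rcases Nat.even_or_odd (k - l) with he | ho
  · simp [he.neg_one_pow, mul_assoc, Nat.cast_smul_eq_nsmul]
  · simp [ho.neg_one_pow, mul_assoc, Nat.cast_smul_eq_nsmul]

/-- On the layer `j + 1`, the last `B k` that can be nonzero is given by one term of the binomial
formula. -/
theorem B_apply_layer_last [CharZero F] [FiniteDimensional F U] {j p q : ℕ}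
    (hp : layerDim A α c j = p + 1) (hq : layerDim A α c (j + 1) = q + 1) :
    ∃ t : F, t ≠ 0 ∧ ∀ u ∈ layer A α c (j + 1), B (p + q) u =
      t • (layerShift A α c j ^ p) (B 0 ((layerShift A α c (j + 1) ^ q) u)) := by
  refine ⟨(-1) ^ q * ((p + q).choose p : F), ?_, fun u hu => ?_⟩
  · refine mul_ne_zero (pow_ne_zero _ (by simp)) ?_
    exact_mod_cast (Nat.choose_pos (Nat.le_add_right p q)).ne'
  · rw [LinearMap.congr_fun (h.B_eq_sum (α := α) (p + q) j) u, LinearMap.sum_apply,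
      Finset.sum_eq_single p]
    · rw [Nat.add_sub_cancel_left]
      rfl
    · intro l _ hl
      rw [LinearMap.smul_apply, Module.End.mul_apply, Module.End.mul_apply]
      rcases lt_or_gt_of_ne hl with hlt | hgt
      · rw [layerShift_pow_layerDim (by omega) hu, map_zero, map_zero, smul_zero]
      · rw [layerShift_pow_layerDim (by omega) (h.B_mem_layer (layerShift_pow_mem_layer hu _)),
          smul_zero]
    · intro hp'
      simp at hp'

theorem B_apply_layer_eq_zero [FiniteDimensional F U] {j p q k : ℕ}
    (hp : layerDim A α c j = p + 1) (hq : layerDim A α c (j + 1) = q + 1) (hk : p + q < k)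
    {u : U} (hu : u ∈ layer A α c (j + 1)) : B k u = 0 := by
  rw [LinearMap.congr_fun (h.B_eq_sum (α := α) k j) u, LinearMap.sum_apply]
  refine Finset.sum_eq_zero fun l _ => ?_
  rw [LinearMap.smul_apply, Module.End.mul_apply, Module.End.mul_apply]
  by_cases hl : l ≤ p
  · rw [layerShift_pow_layerDim (by omega) hu, map_zero, map_zero, smul_zero]
  · rw [layerShift_pow_layerDim (by omega) (h.B_mem_layer (layerShift_pow_mem_layer hu _)),
      smul_zero]

end IsUniserialSystem

end LayerStructure

/-! ### The possible dimensions of the layers -/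

section LayerDimensions

variable {F U : Type*} [Field F] [AddCommGroup U] [Module F U]
variable {n m : ℕ} {α c : F} {A : Module.End F U} {B : ℕ → Module.End F U}

theorem layerDim_pos [FiniteDimensional F U] (hL : HasLayers A α c m) {j : ℕ} (hj : j ≤ m) :
    0 < layerDim A α c j := by
  rw [layerDim, Nat.pos_iff_ne_zero, Ne, Submodule.finrank_eq_zero]
  exact hL.ne_bot j hj

theorem layerShift_pow_ker [FiniteDimensional F U] {j : ℕ} (hpos : 0 < layerDim A α c j) {u : U}
    (hu : u ∈ layer A α c j) :
    layerShift A α c j ((layerShift A α c j ^ (layerDim A α c j - 1)) u) = 0 := by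
  rw [← Module.End.mul_apply, ← pow_succ', Nat.sub_add_cancel hpos]
  exact layerShift_pow_layerDim le_rfl hu

namespace IsUniserialSystem

variable [CharZero F] [FiniteDimensional F U] (h : IsUniserialSystem n c A B)
include h

theorem layerDim_add_le (hc : c ≠ 0) (hL : HasLayers A α c m) {j : ℕ} (hj : j + 1 ≤ m) :
    layerDim A α c j + layerDim A α c (j + 1) ≤ n + 1 := by
  have h1 := layerDim_pos hL (show j ≤ m by omega)
  have h2 := layerDim_pos hL hj
  obtain ⟨p, hp⟩ := Nat.exists_eq_add_of_lt h1
  obtain ⟨q, hq⟩ := Nat.exists_eq_add_of_lt h2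
  rw [Nat.zero_add] at hp hq
  obtain ⟨g, hg, hg0⟩ := h.exists_generator hc hL hj
  obtain ⟨t, ht, hB⟩ := h.B_apply_layer_last hp hq
  have hne := h.layerShift_pow_B_ne_zero hc hL hj (layerShift_pow_mem_layer hg _)
    (layerShift_pow_ker h2 hg) hg0
  rw [hp, hq, Nat.add_sub_cancel, Nat.add_sub_cancel] at hne
  by_contra hlt
  have h0 := hB g hg
  rw [h.vanish (p + q) (by omega), LinearMap.zero_apply] at h0
  exact smul_ne_zero ht hne h0.symm

theorem exists_layerDim_add_eq (hL : HasLayers A α c m) (hc : c ≠ 0) (hn : 1 ≤ n)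
    (hB : B (n - 1) ≠ 0) :
    ∃ j, j + 1 ≤ m ∧ layerDim A α c j + layerDim A α c (j + 1) = n + 1 := by
  by_contra! hall
  apply hB
  ext u
  have hu : u ∈ below A α c (m + 1) := by
    rw [hL.below_eq_top]
    exact Submodule.mem_top
  rw [LinearMap.zero_apply, ← Submodule.mem_bot F]
  refine below_le_of_invariant (fun j hj w hw => ?_) hu
  rw [Submodule.mem_bot]
  rcases j with _ | j
  · exact h.B_apply_layer_zero hL hw
  · obtain ⟨p, hp⟩ := Nat.exists_eq_add_of_lt (layerDim_pos hL (show j ≤ m by omega))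
    obtain ⟨q, hq⟩ := Nat.exists_eq_add_of_lt (layerDim_pos hL (show j + 1 ≤ m by omega))
    rw [Nat.zero_add] at hp hq
    have h1 := h.layerDim_add_le hc hL (show j + 1 ≤ m by omega)
    have h2 := hall j (by omega)
    exact h.B_apply_layer_eq_zero hp hq (by omega) hw

/-- If `B (n - 1)` does not kill the layer `j + 1`, then commutation of `B 0` and `B (n - 1)` on an
eigenvector in the layer `j + 2` forces the layers `j` and `j + 2` to be lines. -/
theorem layerDim_of_add_eq (hc : c ≠ 0) (hL : HasLayers A α c m) {j : ℕ} (hj : j + 2 ≤ m)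
    (hsum : layerDim A α c j + layerDim A α c (j + 1) = n + 1) :
    layerDim A α c j = 1 ∧ layerDim A α c (j + 1) = n ∧ layerDim A α c (j + 2) = 1 := by
  have h0 := layerDim_pos hL (show j ≤ m by omega)
  have h1 := layerDim_pos hL (show j + 1 ≤ m by omega)
  have h2 := layerDim_pos hL hj
  obtain ⟨p, hp⟩ := Nat.exists_eq_add_of_lt h0
  obtain ⟨q, hq⟩ := Nat.exists_eq_add_of_lt h1
  obtain ⟨r, hr⟩ := Nat.exists_eq_add_of_lt h2
  rw [Nat.zero_add] at hp hq hr
  obtain ⟨g, hg, hg0⟩ := h.exists_generator hc hL hj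
  set e := (layerShift A α c (j + 2) ^ (layerDim A α c (j + 2) - 1)) g with he
  have hel : e ∈ layer A α c (j + 2) := layerShift_pow_mem_layer hg _
  have hek : layerShift A α c (j + 2) e = 0 := layerShift_pow_ker h2 hg
  have hBe := h.B_mem_layer (i := 0) hel
  have hne1 := h.layerShift_pow_B_ne_zero hc hL hj hel hek hg0
  have hne2 := h.layerShift_pow_B_ne_zero hc hL (show j + 1 ≤ m by omega)
    (layerShift_pow_mem_layer hBe _) (layerShift_pow_ker h1 hBe) hne1
  obtain ⟨t, ht, hB⟩ := h.B_apply_layer_last hp hq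
  have hBBe := hB _ hBe
  rw [hp, hq, Nat.add_sub_cancel, Nat.add_sub_cancel] at hne2
  have hcomm : B (p + q) (B 0 e) = B 0 (B (p + q) e) :=
    LinearMap.congr_fun (h.comm (p + q) 0) e
  have hle : layerDim A α c (j + 1) + layerDim A α c (j + 2) ≤ n + 1 :=
    h.layerDim_add_le hc hL hj
  have hne3 : B 0 (B (p + q) e) ≠ 0 := by
    rw [← hcomm, hBBe]
    exact smul_ne_zero ht hne2
  have hqr : r = p := by
    by_contra hne
    refine hne3 ?_
    rw [h.B_apply_layer_eq_zero hq hr (by omega) hel, map_zero]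
  obtain ⟨s, hs, hB'⟩ := h.B_apply_layer_last hq hr
  have hr0 : r = 0 := by
    by_contra hr0
    refine hne3 ?_
    rw [show p + q = q + r by omega, hB' e hel]
    obtain ⟨r', rfl⟩ := Nat.exists_eq_succ_of_ne_zero hr0
    rw [pow_succ, Module.End.mul_apply, hek, map_zero, map_zero, map_zero, smul_zero, map_zero]
  omega

/-- The companion of `layerDim_of_add_eq` for the other end of three consecutive layers. -/
theorem layerDim_of_add_eq' (hc : c ≠ 0) (hL : HasLayers A α c m) {j : ℕ} (hj : j + 2 ≤ m)
    (hsum : layerDim A α c (j + 1) + layerDim A α c (j + 2) = n + 1) :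
    layerDim A α c j = 1 ∧ layerDim A α c (j + 1) = n ∧ layerDim A α c (j + 2) = 1 := by
  have h0 := layerDim_pos hL (show j ≤ m by omega)
  have h1 := layerDim_pos hL (show j + 1 ≤ m by omega)
  have h2 := layerDim_pos hL hj
  obtain ⟨p, hp⟩ := Nat.exists_eq_add_of_lt h0
  obtain ⟨q, hq⟩ := Nat.exists_eq_add_of_lt h1
  obtain ⟨r, hr⟩ := Nat.exists_eq_add_of_lt h2
  rw [Nat.zero_add] at hp hq hr
  refine h.layerDim_of_add_eq hc hL hj ?_
  have hle := h.layerDim_add_le hc hL (show j + 1 ≤ m by omega)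
  by_contra hne
  obtain ⟨g, hg, hg0⟩ := h.exists_generator hc hL hj
  obtain ⟨t, ht, hB⟩ := h.B_apply_layer_last hq hr
  have hBe := h.B_mem_layer (i := 0) (layerShift_pow_mem_layer hg (layerDim A α c (j + 2) - 1))
  have hne1 := h.layerShift_pow_B_ne_zero hc hL hj (layerShift_pow_mem_layer hg _)
    (layerShift_pow_ker h2 hg) hg0
  have hne2 := h.layerShift_pow_B_ne_zero hc hL (show j + 1 ≤ m by omega)
    (layerShift_pow_mem_layer hBe _) (layerShift_pow_ker h1 hBe) hne1
  have hzero : B (q + r) (B 0 g) = 0 :=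
    h.B_apply_layer_eq_zero hp hq (by omega) (h.B_mem_layer hg)
  have hcomm : B (q + r) (B 0 g) = B 0 (B (q + r) g) :=
    LinearMap.congr_fun (h.comm (q + r) 0) g
  rw [hzero, hB g hg, map_smul] at hcomm
  rw [hq, hr, Nat.add_sub_cancel, Nat.add_sub_cancel] at hne2
  refine smul_ne_zero ht (fun h' => hne2 ?_) hcomm.symm
  rw [h', map_zero]

/-- For `n > 1`, there are two layers of total dimension `n + 1`, or three layers of dimensions
`1, n, 1`. -/
theorem layerDim_cases (hc : c ≠ 0) (hL : HasLayers A α c m) (hn : 1 < n) (hB : B (n - 1) ≠ 0) :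
    (m = 1 ∧ layerDim A α c 0 + layerDim A α c 1 = n + 1) ∨
    (m = 2 ∧ layerDim A α c 0 = 1 ∧ layerDim A α c 1 = n ∧ layerDim A α c 2 = 1) := by
  obtain ⟨j, hj, hsum⟩ := h.exists_layerDim_add_eq hL hc hn.le hB
  by_cases hj2 : j + 2 ≤ m
  · have h3 := h.layerDim_of_add_eq hc hL hj2 hsum
    have hm : m = j + 2 := by
      by_contra hne
      have h4 := h.layerDim_of_add_eq hc hL (j := j + 1) (by omega)
        (by rw [h3.2.1, h3.2.2])
      omega
    rcases j with _ | j
    · exact Or.inr ⟨hm, h3⟩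
    · have h4 := h.layerDim_of_add_eq' hc hL (j := j) (by omega) hsum
      omega
  · have hm : m = j + 1 := by omega
    rcases j with _ | j
    · exact Or.inl ⟨hm, hsum⟩
    · have h3 := h.layerDim_of_add_eq' hc hL (j := j) hj hsum
      rcases j with _ | j
      · exact Or.inr ⟨hm, h3⟩
      · have h4 := h.layerDim_of_add_eq' hc hL (j := j) (by omega)
          (by rw [h3.1, h3.2.1, add_comm])
        omega

end IsUniserialSystem

end LayerDimensions

/-! ### From representations to operator systems -/

section RepToSystem

variable {F V U : Type*} [Field F] [LieRing V] [LieAlgebra F V] [IsLieAbelian V]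
  [AddCommGroup U] [Module F U] {n : ℕ} {x : Module.End F V} {v : Module.Basis (Fin n) F V} {c : F}

/-- The operator by which `x` acts. -/
def repA (R : LineSemidirect x →ₗ⁅F⁆ Module.End F U) : Module.End F U := R ⟨0, 1⟩

/-- The operator by which `v_i` acts, where `v_i = 0` for `i ≥ n`. -/
noncomputable def repB (v : Module.Basis (Fin n) F V)
    (R : LineSemidirect x →ₗ⁅F⁆ Module.End F U) (i : ℕ) : Module.End F U :=
  if h : i < n then R ⟨v ⟨i, h⟩, 0⟩ else 0

theorem repB_of_lt (R : LineSemidirect x →ₗ⁅F⁆ Module.End F U) (i : Fin n) :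
    repB v R i.val = R ⟨v i, 0⟩ := by
  rw [repB, dif_pos i.isLt]

/-- The restriction of a linear map on `⟨x⟩ ⋉ V` to `V`. -/
def vecRestrict {M : Type*} [AddCommGroup M] [Module F M] (f : LineSemidirect x →ₗ[F] M) :
    V →ₗ[F] M where
  toFun w := f ⟨w, 0⟩
  map_add' w w' := by
    rw [← map_add, LieAlgebra.SemiDirectSum.add_eq_mk]
    simp
  map_smul' t w := by
    rw [RingHom.id_apply, ← map_smul, LieAlgebra.SemiDirectSum.smul_eq_mk]
    simp

theorem rep_eq (v : Module.Basis (Fin n) F V) (R : LineSemidirect x →ₗ⁅F⁆ Module.End F U)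
    (y : LineSemidirect x) :
    R y = y.right • repA R + ∑ i, v.repr y.left i • repB v R i.val := by
  have h1 : y = y.right • (⟨0, 1⟩ : LineSemidirect x) + ⟨y.left, 0⟩ := by
    rw [LieAlgebra.SemiDirectSum.smul_eq_mk, LieAlgebra.SemiDirectSum.add_eq_mk]
    simp
  have h2 : R ⟨y.left, 0⟩ = vecRestrict (R : LineSemidirect x →ₗ[F] Module.End F U) y.left := rfl
  conv_lhs => rw [h1]
  rw [map_add, map_smul, h2]
  conv_lhs => rw [← v.sum_repr y.left]
  rw [map_sum]
  congr 1
  refine Finset.sum_congr rfl fun i _ => ?_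
  rw [map_smul, repB_of_lt]
  rfl

omit [IsLieAbelian V] in
theorem apply_basis_of_toMatrix_eq_lowerJordan (hx : LinearMap.toMatrix v v x = lowerJordan n c)
    (k : Fin n) :
    x (v k) = c • v k + if h : k.val + 1 < n then v ⟨k.val + 1, h⟩ else 0 := by
  have h1 : x (v k) = ∑ i, lowerJordan n c i k • v i := by
    rw [← hx, ← v.sum_repr (x (v k))]
    simp [LinearMap.toMatrix_apply]
  have h3 : ∀ i : Fin n, lowerJordan n c i k • v i =
      (if i = k then c • v k else 0) + (if i.val = k.val + 1 then v i else 0) := by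
    intro i
    by_cases hik : i = k
    · subst hik
      simp [lowerJordan]
    · by_cases hs : i.val = k.val + 1
      · simp [lowerJordan, hik, hs]
      · simp [lowerJordan, hik, hs]
  rw [h1, Finset.sum_congr rfl fun i _ => h3 i, Finset.sum_add_distrib,
    Finset.sum_ite_eq' Finset.univ k, if_pos (Finset.mem_univ k)]
  congr 1
  split_ifs with hk
  · rw [Finset.sum_eq_single (⟨k.val + 1, hk⟩ : Fin n)]
    · simp
    · intro b _ hb
      rw [if_neg]
      exact fun h => hb (Fin.ext h)
    · simp
  · refine Finset.sum_eq_zero fun b _ => ?_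
    rw [if_neg (by omega)]

theorem repA_mul_repB_sub (hx : LinearMap.toMatrix v v x = lowerJordan n c)
    (R : LineSemidirect x →ₗ⁅F⁆ Module.End F U) (i : ℕ) :
    repA R * repB v R i - repB v R i * repA R = c • repB v R i + repB v R (i + 1) := by
  by_cases hi : i < n
  · have h1 : repB v R (i + 1) =
        R ⟨if h : i + 1 < n then v ⟨i + 1, h⟩ else 0, 0⟩ := by
      rw [repB]
      split_ifs
      · rfl
      · exact (map_zero R).symm
    have h2 : repB v R i = R ⟨v ⟨i, hi⟩, 0⟩ := repB_of_lt R ⟨i, hi⟩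
    rw [h1, h2, repA, ← map_smul, ← map_add, ← Ring.lie_def, ← LieHom.map_lie,
      LineSemidirect.lie_eq, LieAlgebra.SemiDirectSum.smul_eq_mk,
      LieAlgebra.SemiDirectSum.add_eq_mk]
    congr 1
    simp [apply_basis_of_toMatrix_eq_lowerJordan hx]
  · simp [repB, hi, show ¬ i + 1 < n by omega]

theorem repB_mul_comm (R : LineSemidirect x →ₗ⁅F⁆ Module.End F U) (i j : ℕ) :
    repB v R i * repB v R j = repB v R j * repB v R i := by
  by_cases hi : i < n
  · by_cases hj : j < n
    · have h1 : repB v R i = R ⟨v ⟨i, hi⟩, 0⟩ := repB_of_lt R ⟨i, hi⟩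
      have h2 : repB v R j = R ⟨v ⟨j, hj⟩, 0⟩ := repB_of_lt R ⟨j, hj⟩
      rw [← sub_eq_zero, h1, h2, ← Ring.lie_def, ← LieHom.map_lie, LineSemidirect.lie_eq]
      simp only [zero_smul, sub_zero]
      exact map_zero R
    · simp [repB, hj]
  · simp [repB, hi]

theorem isUniserialSystem_of_isUniserialRep
    (hx : LinearMap.toMatrix v v x = lowerJordan n c)
    {R : LineSemidirect x →ₗ⁅F⁆ Module.End F U} (hR : IsUniserialRep R) :
    IsUniserialSystem n c (repA R) (repB v R) where
  lie := repA_mul_repB_sub hx R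
  comm := repB_mul_comm R
  vanish i hi := by rw [repB, dif_neg (by omega)]
  chain W W' hA hB hA' hB' := by
    have key : ∀ W : Submodule F U, (∀ u ∈ W, repA R u ∈ W) → (∀ i, ∀ u ∈ W, repB v R i u ∈ W) →
        ∀ y : LineSemidirect x, ∀ u ∈ W, R y u ∈ W := by
      intro W hA hB y u hu
      rw [rep_eq v R y, LinearMap.add_apply, LinearMap.smul_apply, LinearMap.sum_apply]
      refine add_mem (W.smul_mem _ (hA u hu)) (sum_mem fun i _ => ?_)
      exact W.smul_mem _ (hB i u hu)
    exact hR.2 W W' (key W hA hB) (key W' hA' hB')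

theorem repB_last_ne_zero {R : LineSemidirect x →ₗ⁅F⁆ Module.End F U}
    (hR : Function.Injective R) (hn : 1 ≤ n) : repB v R (n - 1) ≠ 0 := by
  have h1 : repB v R (n - 1) = R ⟨v ⟨n - 1, by omega⟩, 0⟩ := repB_of_lt R ⟨n - 1, by omega⟩
  rw [h1]
  intro h0
  have h2 := hR (h0.trans (map_zero R).symm)
  exact v.ne_zero ⟨n - 1, by omega⟩ (congrArg LieAlgebra.SemiDirectSum.left h2)

variable {ι : Type*} [Fintype ι] [DecidableEq ι]

/-- The recursion `B (i + 1) = [A, B i] - c B i` carried over to matrices. -/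
theorem apply_B_eq_adShift_mulVec {A : Module.End F U} {B : ℕ → Module.End F U}
    (hlie : ∀ i, A * B i - B i * A = c • B i + B (i + 1)) {A' E : Matrix ι ι F}
    {T : U →ₗ[F] (ι → F)} (hA : ∀ u, T (A u) = A' *ᵥ T u) (hE : ∀ u, T (B 0 u) = E *ᵥ T u)
    (k : ℕ) (u : U) : T (B k u) = (adShift A' c ^ k) E *ᵥ T u := by
  induction k generalizing u with
  | zero => simpa using hE u
  | succ k ih =>
    have h1 : B (k + 1) = A * B k - B k * A - c • B k := by rw [hlie k]; abel
    rw [h1, pow_succ', Module.End.mul_apply, adShift_apply]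
    simp only [LinearMap.sub_apply, Module.End.mul_apply, LinearMap.smul_apply, map_sub, map_smul,
      hA, ih, Matrix.sub_mulVec, Matrix.mulVec_mulVec, Matrix.smul_mulVec]

theorem isoToMatrixRep_jordanRep (hx : LinearMap.toMatrix v v x = lowerJordan n c)
    {R : LineSemidirect x →ₗ⁅F⁆ Module.End F U} {A E : Matrix ι ι F}
    (hE : (adShift A c ^ n) E = 0)
    (hcomm : ∀ i j : Fin n, Commute ((adShift A c ^ i.val) E) ((adShift A c ^ j.val) E))
    (T : U ≃ₗ[F] (ι → F)) (hTA : ∀ u, T (repA R u) = A *ᵥ T u)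
    (hTB : ∀ u, T (repB v R 0 u) = E *ᵥ T u) :
    IsoToMatrixRep R (jordanRep hx A E hE hcomm) := by
  refine ⟨T, fun y u => ?_⟩
  have hy : jordanRep hx A E hE hcomm y = y.right • A + vecPart v c A E y.left := rfl
  have hB := apply_B_eq_adShift_mulVec (T := T.toLinearMap) (repA_mul_repB_sub hx R) hTA hTB
  simp only [LinearEquiv.coe_coe] at hB
  rw [rep_eq v R y, hy, vecPart, Module.Basis.constr_apply_fintype]
  simp only [LinearMap.add_apply, LinearMap.smul_apply, LinearMap.sum_apply, map_add, map_smul,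
    map_sum, Matrix.add_mulVec, Matrix.smul_mulVec, Matrix.sum_mulVec, hTA, hB,
    Module.Basis.equivFun_apply]

theorem exists_coord_of_isoToMatrixRep_jordanRep (hn : 1 ≤ n)
    (hx : LinearMap.toMatrix v v x = lowerJordan n c)
    {R : LineSemidirect x →ₗ⁅F⁆ Module.End F U} {A E : Matrix ι ι F}
    {hE : (adShift A c ^ n) E = 0}
    {hcomm : ∀ i j : Fin n, Commute ((adShift A c ^ i.val) E) ((adShift A c ^ j.val) E)}
    (h : IsoToMatrixRep R (jordanRep hx A E hE hcomm)) :
    ∃ T : U ≃ₗ[F] (ι → F), (∀ u, T (repA R u) = A *ᵥ T u) ∧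
      ∀ u, T (repB v R 0 u) = E *ᵥ T u := by
  obtain ⟨T, hT⟩ := h
  have hy : ∀ y, jordanRep hx A E hE hcomm y = y.right • A + vecPart v c A E y.left :=
    fun _ => rfl
  refine ⟨T, fun u => ?_, fun u => ?_⟩
  · rw [repA, hT, hy]
    simp
  · rw [show repB v R 0 = R ⟨v ⟨0, hn⟩, 0⟩ from repB_of_lt R ⟨0, hn⟩, hT, hy, vecPart_basis]
    simp

end RepToSystem

/-! ### Coordinates assembled from two layers -/

section Assemble

variable {F U : Type*} [Field F] [AddCommGroup U] [Module F U]

theorem exists_sum_coord {ι κ : Type*} {P Q : Submodule F U} (hPQ : IsCompl P Q)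
    (S : P ≃ₗ[F] (ι → F)) (T : Q ≃ₗ[F] (κ → F)) :
    ∃ Z : U ≃ₗ[F] (ι ⊕ κ → F), (∀ (a : P) (b : Q), Z (a + b) = Sum.elim (S a) (T b)) := by
  refine ⟨(P.prodEquivOfIsCompl Q hPQ).symm ≪≫ₗ (S.prodCongr T) ≪≫ₗ
    (LinearEquiv.sumArrowLequivProdArrow ι κ F F).symm, fun a b => ?_⟩
  have h : (P.prodEquivOfIsCompl Q hPQ).symm (a + b) = (a, b) := by
    rw [LinearEquiv.symm_apply_eq]
    simp
  simp only [LinearEquiv.trans_apply, h]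
  ext i
  rcases i with i | i <;> simp

theorem exists_triple_coord {ι κ μ : Type*} {P Q R : Submodule F U} (hQR : Disjoint Q R)
    (hP : IsCompl P (Q ⊔ R)) (S : P ≃ₗ[F] (ι → F)) (T : Q ≃ₗ[F] (κ → F))
    (W : R ≃ₗ[F] (μ → F)) :
    ∃ Z : U ≃ₗ[F] (ι ⊕ (κ ⊕ μ) → F), (∀ (a : P) (b : Q) (d : R),
      Z (a + (b + d)) = Sum.elim (S a) (Sum.elim (T b) (W d))) := by
  have hle1 : Q ≤ Q ⊔ R := le_sup_left
  have hle2 : R ≤ Q ⊔ R := le_sup_right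
  have hcompl : IsCompl (Q.submoduleOf (Q ⊔ R)) (R.submoduleOf (Q ⊔ R)) := by
    constructor
    · rw [Submodule.disjoint_def]
      intro u hu hu'
      exact Subtype.ext (Submodule.disjoint_def.mp hQR u hu hu')
    · rw [codisjoint_iff, eq_top_iff]
      rintro ⟨u, hu⟩ -
      obtain ⟨a, ha, b, hb, hab⟩ := Submodule.mem_sup.mp hu
      exact Submodule.mem_sup.mpr ⟨⟨a, hle1 ha⟩, ha, ⟨b, hle2 hb⟩, hb, Subtype.ext hab⟩
  obtain ⟨Y, hY⟩ := exists_sum_coord hcompl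
    (Submodule.submoduleOfEquivOfLe hle1 ≪≫ₗ T) (Submodule.submoduleOfEquivOfLe hle2 ≪≫ₗ W)
  obtain ⟨Z, hZ⟩ := exists_sum_coord hP S Y
  refine ⟨Z, fun a b d => ?_⟩
  have h1 := hY ⟨⟨b, hle1 b.2⟩, b.2⟩ ⟨⟨d, hle2 d.2⟩, d.2⟩
  have h2 := hZ a (⟨b, hle1 b.2⟩ + ⟨d, hle2 d.2⟩)
  rw [h1] at h2
  exact h2

variable {n m : ℕ} {α c : F} {A : Module.End F U} {B : ℕ → Module.End F U}

theorem layer_coord_apply {j q : ℕ} {T : layer A α c j ≃ₗ[F] (Fin q → F)}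
    (hT : ∀ u, T (layerNil A α c j u) = upperJordan q 0 *ᵥ T u) (u : layer A α c j) :
    T ⟨A u, apply_mem_layer u.2⟩ = upperJordan q (α - j * c) *ᵥ T u := by
  have h1 : (⟨A u, apply_mem_layer u.2⟩ : layer A α c j) =
      layerNil A α c j u + (α - j * c) • u := by
    apply Subtype.ext
    rw [Submodule.coe_add, Submodule.coe_smul, coe_layerNil, layerShift_apply, sub_add_cancel]
  rw [h1, map_add, map_smul, hT, upperJordan_eq q (α - j * c), Matrix.add_mulVec,
    Matrix.smul_mulVec, Matrix.one_mulVec]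

theorem lastVec_apply {q : ℕ} (hq : 0 < q) : lastVec F q ⟨q - 1, by omega⟩ = 1 := by
  simp only [lastVec]
  rw [if_pos (by omega)]

namespace IsUniserialSystem

variable (h : IsUniserialSystem n c A B)
include h

/-- The map from the layer `j + 1` to the layer `j` induced by `B 0`. -/
def layerMap (j : ℕ) : layer A α c (j + 1) →ₗ[F] layer A α c j :=
  (B 0).restrict fun _ hu => h.B_mem_layer hu

theorem exists_eigenvector [CharZero F] [FiniteDimensional F U] (hc : c ≠ 0)
    (hL : HasLayers A α c m) {j : ℕ} (hj : j + 1 ≤ m) :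
    ∃ e : layer A α c (j + 1), e ≠ 0 ∧ layerNil A α c (j + 1) e = 0 := by
  obtain ⟨g, hg, hg0⟩ := h.exists_generator hc hL hj
  refine ⟨⟨_, layerShift_pow_mem_layer hg (layerDim A α c (j + 1) - 1)⟩, ?_, ?_⟩
  · intro h0
    exact hg0 (congrArg Subtype.val h0)
  · exact Subtype.ext (layerShift_pow_ker (layerDim_pos hL hj) hg)

theorem layerNil_pow_layerMap_ne_zero [CharZero F] [FiniteDimensional F U] (hc : c ≠ 0)
    (hL : HasLayers A α c m) {j : ℕ} (hj : j + 1 ≤ m) {e : layer A α c (j + 1)} (he : e ≠ 0)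
    (hNe : layerNil A α c (j + 1) e = 0) :
    (layerNil A α c j ^ (layerDim A α c j - 1)) (h.layerMap j e) ≠ 0 := by
  intro h0
  refine h.layerShift_pow_B_ne_zero hc hL hj e.2 ?_ (by simpa using he) ?_
  · rw [← coe_layerNil, hNe]
    rfl
  · have := congrArg Subtype.val h0
    rwa [coe_layerNil_pow] at this

theorem exists_smul_eq_of_layerNil_eq_zero [CharZero F] (hc : c ≠ 0) (hL : HasLayers A α c m)
    {j : ℕ} {u u' : layer A α c j} (h0 : layerNil A α c j u = 0) (h0' : layerNil A α c j u' = 0)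
    (hne : u ≠ 0) : ∃ t : F, u' = t • u := by
  obtain ⟨t, ht⟩ := h.exists_smul_eq_of_layerShift_eq_zero hc hL u.2 u'.2
    (by rw [← coe_layerNil, h0]; rfl) (by rw [← coe_layerNil, h0']; rfl) (by simpa using hne)
  exact ⟨t, Subtype.ext ht⟩

/-- Two layers: normal coordinates. The layer `0` is coordinatized by the cyclic vector `B 0 e`,
where `e` is an eigenvector in the layer `1`, and the layer `1` by the functional that sends `u` to
the last coordinate of `B 0 u`. These two choices give the first column and the last row of the
matrix of `B 0` the prescribed form. -/
theorem exists_coord_of_two_layers [CharZero F] [FiniteDimensional F U] (hc : c ≠ 0)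
    (hL : HasLayers A α c 1) {k : ℕ} (hk : layerDim A α c 0 = k) (hk1 : 1 ≤ k) (hkn : k ≤ n)
    (hq : layerDim A α c 1 = n + 1 - k) :
    ∃ (X : Matrix (Fin (k - 1)) (Fin (n - k)) F)
      (T : U ≃ₗ[F] (Fin k ⊕ Fin (n + 1 - k) → F)),
      (∀ u, T (A u) = twoBlockA k (n + 1 - k) α c *ᵥ T u) ∧
      ∀ u, T (B 0 u) = Matrix.fromBlocks 0 (cornerN X) 0 0 *ᵥ T u := by
  obtain ⟨e, he0, hNe⟩ := h.exists_eigenvector hc hL (le_refl 1)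
  have hg := h.layerNil_pow_layerMap_ne_zero hc hL (le_refl 1) he0 hNe
  rw [hk] at hg
  obtain ⟨S, hSg, hSN⟩ := exists_jordan_coord_of_generator hk (isNilpotent_layerNil 0) _ hg
  let φ : layer A α c 1 →ₗ[F] F :=
    LinearMap.proj (⟨k - 1, by omega⟩ : Fin k) ∘ₗ S.toLinearMap ∘ₗ h.layerMap 0
  have hφ : ∀ u, φ u = S (h.layerMap 0 u) ⟨k - 1, by omega⟩ := fun _ => rfl
  have hφe : φ e = 1 := by rw [hφ, hSg, lastVec_apply hk1]
  obtain ⟨T, hTφ, hTN⟩ := exists_jordan_coord_of_functional hq (isNilpotent_layerNil 1) φ (by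
    intro u hu hφu
    obtain ⟨t, rfl⟩ := h.exists_smul_eq_of_layerNil_eq_zero hc hL hNe hu he0
    rw [map_smul, hφe, smul_eq_mul, mul_one] at hφu
    rw [hφu, zero_smul])
  have hTe : T e = Pi.single (⟨0, by omega⟩ : Fin (n + 1 - k)) 1 := by
    ext l
    rw [hTφ]
    rcases l with ⟨_ | l, hl⟩
    · simpa using hφe
    · rw [pow_succ, Module.End.mul_apply, hNe, map_zero, map_zero, Pi.single_apply,
        if_neg (by simp)]
  let N : Matrix (Fin k) (Fin (n + 1 - k)) F :=
    LinearMap.toMatrix' (S.toLinearMap ∘ₗ h.layerMap 0 ∘ₗ T.symm.toLinearMap)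
  have hN : ∀ u, S (h.layerMap 0 u) = N *ᵥ T u := by
    intro u
    rw [← Matrix.toLin'_apply, Matrix.toLin'_toMatrix']
    simp
  have hNij : ∀ i j, N i j = S (h.layerMap 0 (T.symm (Pi.single j 1))) i := by
    intro i j
    rw [hN, LinearEquiv.apply_symm_apply, Matrix.mulVec_single_one]
    rfl
  let X : Matrix (Fin (k - 1)) (Fin (n - k)) F :=
    Matrix.of fun i j => N ⟨i.val, by omega⟩ ⟨j.val + 1, by omega⟩
  have hX : cornerN X = N := by
    ext i j
    by_cases hij : i.val < k - 1 ∧ 0 < j.val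
    · simp only [cornerN, Matrix.of_apply, dif_pos hij, X]
      congr 1
      exact Fin.ext (by simp; omega)
    · simp only [cornerN, Matrix.of_apply, dif_neg hij]
      -- First column: `S (B 0 e)` is the last canonical vector. Last row: it is `φ`, which is
      -- the first coordinate of `T`.
      by_cases hj : j.val = 0
      · have hj' : j = ⟨0, by omega⟩ := Fin.ext hj
        rw [hNij, hj', ← hTe, LinearEquiv.symm_apply_apply, hSg, lastVec]
        congr 1
        apply propext
        simp only [and_true]
        omega
      · have hi : i = ⟨k - 1, by omega⟩ := Fin.ext (by simp; omega)
        rw [if_neg (by omega), hNij, hi, ← hφ]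
        have h0 := hTφ (T.symm (Pi.single j 1)) ⟨0, by omega⟩
        rw [LinearEquiv.apply_symm_apply, pow_zero, Module.End.one_apply] at h0
        rw [← h0, Pi.single_apply, if_neg]
        intro hj'
        exact hj (by rw [← hj'])
  have hcompl : IsCompl (layer A α c 0) (layer A α c 1) := by
    have h01 := disjoint_layer_below (A := A) (α := α) hc (le_refl 1)
    have htop := hL.below_eq_top
    rw [below_succ, below_succ, below_zero, sup_bot_eq] at htop
    rw [below_succ, below_zero, sup_bot_eq] at h01
    exact ⟨h01.symm, codisjoint_iff.mpr (by rw [sup_comm]; exact htop)⟩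
  obtain ⟨Z, hZ⟩ := exists_sum_coord hcompl S T
  have hsplit : ∀ u : U, ∃ (a : layer A α c 0) (b : layer A α c 1), u = a + b := by
    intro u
    obtain ⟨a, ha, b, hb, hab⟩ := Submodule.mem_sup.mp
      (show u ∈ layer A α c 0 ⊔ layer A α c 1 by rw [hcompl.sup_eq_top]; exact Submodule.mem_top)
    exact ⟨⟨a, ha⟩, ⟨b, hb⟩, hab.symm⟩
  refine ⟨X, Z, fun u => ?_, fun u => ?_⟩
  · obtain ⟨a, b, rfl⟩ := hsplit u
    have h1 := hZ ⟨A a, apply_mem_layer a.2⟩ ⟨A b, apply_mem_layer b.2⟩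
    rw [layer_coord_apply hSN, layer_coord_apply hTN] at h1
    rw [map_add A, h1, hZ, twoBlockA, Matrix.fromBlocks_mulVec]
    simp
  · obtain ⟨a, b, rfl⟩ := hsplit u
    have h1 := hZ (h.layerMap 0 b) 0
    rw [Submodule.coe_zero, add_zero, map_zero, hN] at h1
    rw [map_add (B 0), h.B_apply_layer_zero hL a.2, zero_add, hZ, hX, Matrix.fromBlocks_mulVec]
    refine h1.trans ?_
    simp

end IsUniserialSystem

end Assemble

/-! ### Three layers, and layers of dimension one -/

section AssembleThree

variable {F U : Type*} [Field F] [AddCommGroup U] [Module F U]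

theorem exists_unit_coord {W : Type*} [AddCommGroup W] [Module F W]
    (hW : Module.finrank F W = 1) {e : W} (he : e ≠ 0) :
    ∃ T : W ≃ₗ[F] (Unit → F), T e = fun _ => 1 := by
  let b := FiniteDimensional.basisSingleton Unit hW e he
  refine ⟨b.equivFun, ?_⟩
  have hb : e = b () := by simp [b]
  rw [hb]
  ext i
  simp

variable {n m : ℕ} {α c : F} {A : Module.End F U} {B : ℕ → Module.End F U}

theorem apply_eq_smul_of_layerDim_eq_one [FiniteDimensional F U] {j : ℕ}
    (hj : layerDim A α c j = 1) {u : U} (hu : u ∈ layer A α c j) : A u = (α - j * c) • u := by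
  have := layerShift_pow_layerDim hj.le hu
  rwa [pow_one, layerShift_apply, sub_eq_zero] at this

namespace IsUniserialSystem

variable (h : IsUniserialSystem n c A B)
include h

/-- Three layers of dimensions `1, n, 1`: normal coordinates. The coordinates on the layer `1` have
the image of the basis vector of the layer `2` as their cyclic vector, and the image of the
eigenvector in the layer `1` is the basis vector of the layer `0`. -/
theorem exists_coord_of_three_layers [CharZero F] [FiniteDimensional F U] (hc : c ≠ 0)
    (hL : HasLayers A α c 2) (hn : 1 ≤ n) (h0 : layerDim A α c 0 = 1) (h1 : layerDim A α c 1 = n)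
    (h2 : layerDim A α c 2 = 1) :
    ∃ (a : Fin n → F) (T : U ≃ₗ[F] (ThreeIdx n → F)), a ⟨0, hn⟩ = 1 ∧
      (∀ u, T (A u) = threeBlockA n α c *ᵥ T u) ∧
      ∀ u, T (B 0 u) = threeBlockE a (lastVec F n) *ᵥ T u := by
  obtain ⟨e₂, he₂, hNe₂⟩ := h.exists_eigenvector hc hL (le_refl 2)
  have hg₁ := h.layerNil_pow_layerMap_ne_zero hc hL (le_refl 2) he₂ hNe₂
  rw [h1] at hg₁
  obtain ⟨T₁, hT₁g, hT₁N⟩ := exists_jordan_coord_of_generator h1 (isNilpotent_layerNil 1) _ hg₁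
  obtain ⟨T₂, hT₂⟩ := exists_unit_coord h2 he₂
  set e₁ := T₁.symm (Pi.single (⟨0, hn⟩ : Fin n) 1) with he₁
  have hT₁e : T₁ e₁ = Pi.single (⟨0, hn⟩ : Fin n) 1 := T₁.apply_symm_apply _
  have he₁0 : e₁ ≠ 0 := by
    intro h0
    rw [h0, map_zero] at hT₁e
    simpa using congr_fun hT₁e ⟨0, hn⟩
  have hNe₁ : layerNil A α c 1 e₁ = 0 := by
    apply T₁.injective
    rw [hT₁N, hT₁e, map_zero]
    ext i
    rw [upperJordan_zero_mulVec_apply]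
    split_ifs
    · simp
    · rfl
  have hg₀ := h.layerNil_pow_layerMap_ne_zero hc hL (show 0 + 1 ≤ 2 by norm_num) he₁0 hNe₁
  rw [h0, Nat.sub_self, pow_zero, Module.End.one_apply] at hg₀
  obtain ⟨T₀, hT₀⟩ := exists_unit_coord h0 hg₀
  -- `a` is the row of `B 0` from the layer `1` to the layer `0`; its first entry is `1` by the
  -- choice of `T₀`.
  let a : Fin n → F := fun i => T₀ (h.layerMap 0 (T₁.symm (Pi.single i 1))) ()
  have ha : ∀ u, T₀ (h.layerMap 0 u) () = a ⬝ᵥ T₁ u := by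
    intro u
    have hu : u = ∑ i, T₁ u i • T₁.symm (Pi.single i 1) := by
      apply T₁.injective
      simp only [map_sum, map_smul, LinearEquiv.apply_symm_apply]
      exact pi_eq_sum_univ' (T₁ u)
    conv_lhs => rw [hu]
    simp [a, dotProduct, mul_comm]
  have hb : ∀ u, T₁ (h.layerMap 1 u) = T₂ u () • lastVec F n := by
    intro u
    have hu : u = T₂ u () • e₂ := by
      apply T₂.injective
      ext
      simp [hT₂]
    conv_lhs => rw [hu, map_smul, map_smul, hT₁g]
  have htop := hL.below_eq_top
  have hd1 := disjoint_layer_below (A := A) (α := α) hc (le_refl 1)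
  have hd2 := disjoint_layer_below (A := A) (α := α) hc (le_refl 2)
  rw [below_succ, below_succ, below_succ, below_zero, sup_bot_eq] at htop
  rw [below_succ, below_succ, below_zero, sup_bot_eq] at hd2
  rw [below_succ, below_zero, sup_bot_eq] at hd1
  have hQR : Disjoint (layer A α c 1) (layer A α c 2) := (hd2.mono_right le_sup_left).symm
  have hcompl : IsCompl (layer A α c 0) (layer A α c 1 ⊔ layer A α c 2) := by
    constructor
    · have := hd1.symm.disjoint_sup_right_of_disjoint_sup_left (c := layer A α c 2)
        (by rw [sup_comm]; exact hd2.symm)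
      exact this
    · rw [codisjoint_iff, ← htop]
      ac_rfl
  obtain ⟨Z, hZ⟩ := exists_triple_coord hQR hcompl T₀ T₁ T₂
  have hsplit : ∀ u : U, ∃ (a : layer A α c 0) (b : layer A α c 1) (d : layer A α c 2),
      u = a + (b + d) := by
    intro u
    obtain ⟨a, ha, w, hw, haw⟩ := Submodule.mem_sup.mp
      (show u ∈ layer A α c 0 ⊔ (layer A α c 1 ⊔ layer A α c 2) by
        rw [hcompl.sup_eq_top]; exact Submodule.mem_top)
    obtain ⟨b, hb, d, hd, hbd⟩ := Submodule.mem_sup.mp hw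
    exact ⟨⟨a, ha⟩, ⟨b, hb⟩, ⟨d, hd⟩, by rw [← haw, ← hbd]⟩
  refine ⟨a, Z, ?_, fun u => ?_, fun u => ?_⟩
  · change T₀ (h.layerMap 0 e₁) () = 1
    rw [hT₀]
  · obtain ⟨p, q, r, rfl⟩ := hsplit u
    have hz := hZ ((α - (0 : ℕ) * c) • p) ⟨A q, apply_mem_layer q.2⟩ ((α - (2 : ℕ) * c) • r)
    rw [layer_coord_apply hT₁N] at hz
    rw [map_add A, map_add A, apply_eq_smul_of_layerDim_eq_one h0 p.2,
      apply_eq_smul_of_layerDim_eq_one h2 r.2]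
    refine hz.trans ?_
    rw [hZ, threeBlockA, Matrix.fromBlocks_mulVec]
    ext i
    rcases i with i | i | i
    · simp [Matrix.mulVec, dotProduct]
    · simp [Matrix.fromBlocks_mulVec]
    · simp [Matrix.fromBlocks_mulVec, Matrix.mulVec, dotProduct]
  · obtain ⟨p, q, r, rfl⟩ := hsplit u
    have hz := hZ (h.layerMap 0 q) (h.layerMap 1 r) 0
    rw [hb, Submodule.coe_zero, add_zero, map_zero] at hz
    rw [map_add (B 0), map_add (B 0), h.B_apply_layer_zero hL p.2, zero_add]
    refine hz.trans ?_
    rw [hZ]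
    ext i
    rcases i with i | i | i
    · simp [threeBlockE, ha, Matrix.mulVec, dotProduct]
    · simp [threeBlockE, Matrix.mulVec, dotProduct, Matrix.fromCols, mul_comm]
    · simp [threeBlockE, Matrix.mulVec, dotProduct, Matrix.fromCols]

end IsUniserialSystem

/-- Commutation in the three-block model: with `e` the last canonical vector and `J` the nilpotent
Jordan block, it says `a Jⁱ e = (-1)ⁱ a Jⁱ e`, which kills every second entry of `a`. -/
theorem odd_and_eq_zero_of_commute [CharZero F] {a : Fin n → F} (hn : 1 ≤ n)
    (ha : a ⟨0, hn⟩ = 1)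
    (hcomm : ∀ i, Commute (threeBlockE a (lastVec F n))
      ((adShift (threeBlockA n α c) c ^ i) (threeBlockE a (lastVec F n)))) :
    Odd n ∧ ∀ i : Fin n, Even (i.val + 1) → a i = 0 := by
  have key : ∀ i : Fin n, Odd (n - 1 - i.val) → a i = 0 := by
    intro i hi
    have h1 := hcomm (n - 1 - i.val)
    rw [adShift_threeBlock_pow, Commute, SemiconjBy, threeBlockE_mul, threeBlockE_mul] at h1
    have h2 := congr_fun (congr_fun h1 (Sum.inl ())) (Sum.inr (Sum.inr ()))
    have hidx : (⟨n - 1 - (n - 1 - i.val), by omega⟩ : Fin n) = i := Fin.ext (by simp; omega)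
    simp only [Matrix.fromBlocks_apply₁₂, Matrix.fromCols_apply_inr, Matrix.of_apply,
      smul_dotProduct, ← Matrix.dotProduct_mulVec, vecMul_pow_dot_lastVec, hi.neg_one_pow,
      smul_eq_mul] at h2
    rw [dif_pos (by omega), hidx] at h2
    have h3 : (2 : F) * a i = 0 := by linear_combination h2
    simpa using h3
  have hodd : Odd n := by
    by_contra hne
    rw [Nat.not_odd_iff_even] at hne
    obtain ⟨k, hk⟩ := hne
    have := key ⟨0, hn⟩ ⟨k - 1, by simp; omega⟩
    rw [ha] at this
    exact one_ne_zero this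
  refine ⟨hodd, fun i hi => key i ?_⟩
  obtain ⟨k, hk⟩ := hodd
  obtain ⟨l, hl⟩ := hi
  exact ⟨k - l, by omega⟩

end AssembleThree

section AssembleLines

variable {F U : Type*} [Field F] [AddCommGroup U] [Module F U]
variable {n m : ℕ} {α c : F} {A : Module.End F U} {B : ℕ → Module.End F U}

/-- For `n = 1` all the layers are lines, and the images of a vector of the last layer under the
powers of `B 0` form a basis. -/
theorem IsUniserialSystem.exists_coord_of_one [CharZero F] [FiniteDimensional F U]
    (h : IsUniserialSystem 1 c A B) (hc : c ≠ 0) (hL : HasLayers A α c m) (hB : B 0 ≠ 0) :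
    1 ≤ m ∧ ∃ T : U ≃ₗ[F] (Fin (m + 1) → F),
      (∀ u, T (A u) = Matrix.diagonal (fun i : Fin (m + 1) => α - (i.val : F) * c) *ᵥ T u) ∧
      ∀ u, T (B 0 u) = upperJordan (m + 1) 0 *ᵥ T u := by
  have hm : 1 ≤ m := by
    obtain ⟨j, hj, -⟩ := h.exists_layerDim_add_eq hL hc le_rfl hB
    omega
  have hdim : ∀ j ≤ m, layerDim A α c j = 1 := by
    intro j hj
    rcases Nat.lt_or_ge j m with hlt | hge
    · have h1 := h.layerDim_add_le hc hL (show j + 1 ≤ m from hlt)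
      have h2 := layerDim_pos hL hj
      have h3 := layerDim_pos hL (show j + 1 ≤ m from hlt)
      omega
    · obtain ⟨k, rfl⟩ : ∃ k, j = k + 1 := ⟨j - 1, by omega⟩
      have h1 := h.layerDim_add_le hc hL hj
      have h2 := layerDim_pos hL hj
      have h3 := layerDim_pos hL (show k ≤ m by omega)
      omega
  obtain ⟨e, he, he0⟩ := Submodule.exists_mem_ne_zero_of_ne_bot (hL.ne_bot m le_rfl)
  have hshift : ∀ j ≤ m, ∀ u ∈ layer A α c j, layerShift A α c j u = 0 := by
    intro j hj u hu
    rw [layerShift_apply, apply_eq_smul_of_layerDim_eq_one (hdim j hj) hu, sub_self]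
  have hb : ∀ k ≤ m, (B 0 ^ k) e ∈ layer A α c (m - k) ∧ (B 0 ^ k) e ≠ 0 := by
    intro k
    induction k with
    | zero => exact fun _ => ⟨by simpa using he, by simpa using he0⟩
    | succ k ih =>
      intro hk
      obtain ⟨h1, h2⟩ := ih (by omega)
      rw [show m - k = m - (k + 1) + 1 by omega] at h1
      rw [pow_succ', Module.End.mul_apply]
      refine ⟨h.B_mem_layer h1, ?_⟩
      have h3 := h.layerShift_pow_B_ne_zero hc hL (by omega) h1 (hshift _ (by omega) _ h1) h2
      rwa [hdim _ (by omega), Nat.sub_self, pow_zero, Module.End.one_apply] at h3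
  let w : Fin (m + 1) → U := fun i => (B 0 ^ (m - i.val)) e
  have hw : ∀ i : Fin (m + 1), w i ∈ layer A α c i.val ∧ w i ≠ 0 := by
    intro i
    have := hb (m - i.val) (by omega)
    rwa [show m - (m - i.val) = i.val by omega] at this
  have hAw : ∀ i : Fin (m + 1), A (w i) = (α - (i.val : F) * c) • w i := fun i =>
    apply_eq_smul_of_layerDim_eq_one (hdim _ (by omega)) (hw i).1
  have hli : LinearIndependent F w := by
    refine Module.End.eigenvectors_linearIndependent' A (fun i : Fin (m + 1) => α - (i.val : F) * c)
      (fun i j hij => Fin.ext (layer_injective hc hij)) w fun i => ?_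
    exact Module.End.hasEigenvector_iff.mpr ⟨Module.End.mem_eigenspace_iff.mpr (hAw i), (hw i).2⟩
  have hspan : ⊤ ≤ Submodule.span F (Set.range w) := by
    rw [← hL.below_eq_top]
    refine iSup₂_le fun j hj u hu => ?_
    have hj' : j ≤ m := Nat.lt_succ_iff.mp hj
    obtain ⟨t, ht⟩ := h.exists_smul_eq_of_layerShift_eq_zero hc hL (hw ⟨j, hj⟩).1 hu
      (hshift j hj' _ (hw ⟨j, hj⟩).1) (hshift j hj' _ hu) (hw ⟨j, hj⟩).2
    rw [ht]
    exact Submodule.smul_mem _ _ (Submodule.subset_span ⟨_, rfl⟩)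
  let b := Module.Basis.mk hli hspan
  have hbw : ∀ i, b i = w i := fun i => by simp [b]
  have hbT : ∀ i, b.equivFun (b i) = Pi.single i 1 := by
    intro i
    ext j
    simp [Pi.single_apply, eq_comm]
  refine ⟨hm, b.equivFun, ?_, ?_⟩
  · have key : b.equivFun.toLinearMap ∘ₗ A =
        (Matrix.diagonal (fun i : Fin (m + 1) => α - (i.val : F) * c)).mulVecLin ∘ₗ
          b.equivFun.toLinearMap := by
      refine b.ext fun i => ?_
      simp only [LinearMap.comp_apply, LinearEquiv.coe_coe, Matrix.mulVecLin_apply, hbT]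
      rw [hbw, hAw, ← hbw, map_smul, hbT, Matrix.diagonal_mulVec_single, ← Pi.single_smul,
        smul_eq_mul]
    exact LinearMap.congr_fun key
  · have key : b.equivFun.toLinearMap ∘ₗ B 0 =
        (upperJordan (m + 1) (0 : F)).mulVecLin ∘ₗ b.equivFun.toLinearMap := by
      refine b.ext fun i => ?_
      simp only [LinearMap.comp_apply, LinearEquiv.coe_coe, Matrix.mulVecLin_apply, hbT]
      ext j
      rw [upperJordan_zero_mulVec_apply]
      rcases Nat.eq_zero_or_pos i.val with h0 | h0
      · have : B 0 (b i) = 0 := by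
          rw [hbw]
          exact h.B_apply_layer_zero hL (h0 ▸ (hw i).1)
        rw [this, map_zero]
        split_ifs
        · rw [Pi.single_apply, if_neg]
          · rfl
          · simp only [Fin.ext_iff]; omega
        · rfl
      · have : B 0 (b i) = b ⟨i.val - 1, by omega⟩ := by
          rw [hbw, hbw]
          simp only [w]
          rw [← Module.End.mul_apply, ← pow_succ', show m - i.val + 1 = m - (i.val - 1) by omega]
        rw [this, hbT]
        split_ifs
        · simp only [Pi.single_apply, Fin.ext_iff]
          congr 1
          apply propext
          omega
        · rw [Pi.single_apply, if_neg]
          simp only [Fin.ext_iff]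
          omega
    exact LinearMap.congr_fun key

end AssembleLines

/-! ### Uniqueness of the parameters -/

section Uniqueness

variable {F U : Type*} [Field F] [AddCommGroup U] [Module F U]

theorem upperJordan_mulVec (q : ℕ) (a : F) (w : Fin q → F) :
    upperJordan q a *ᵥ w = upperJordan q 0 *ᵥ w + a • w := by
  rw [upperJordan_eq q a, Matrix.add_mulVec, Matrix.smul_mulVec, Matrix.one_mulVec]

theorem eq_zero_of_upperJordan_mulVec_eq_smul {q : ℕ} {t : F} (ht : t ≠ 0) {w : Fin q → F}
    (hw : upperJordan q 0 *ᵥ w = t • w) : w = 0 := by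
  have h : ∀ k, upperJordan q 0 ^ k *ᵥ w = t ^ k • w := by
    intro k
    induction k with
    | zero => simp
    | succ k ih =>
      rw [pow_succ', ← Matrix.mulVec_mulVec, ih, Matrix.mulVec_smul, hw, smul_smul, pow_succ]
  have := h q
  rw [upperJordan_pow_self, Matrix.zero_mulVec] at this
  exact (smul_eq_zero.mp this.symm).resolve_left (pow_ne_zero _ ht)

theorem eq_smul_single_of_upperJordan_mulVec_eq_zero {q : ℕ} (hq : 0 < q) {w : Fin q → F}
    (hw : upperJordan q 0 *ᵥ w = 0) : w = w ⟨0, hq⟩ • Pi.single ⟨0, hq⟩ 1 := by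
  ext i
  rcases i with ⟨_ | i, hi⟩
  · simp
  · have := congr_fun hw ⟨i, by omega⟩
    rw [upperJordan_zero_mulVec_apply, dif_pos hi] at this
    simpa [Pi.single_apply] using this

theorem charpoly_upperJordan (q : ℕ) (a : F) :
    (upperJordan q a).charpoly = (Polynomial.X - Polynomial.C a) ^ q := by
  rw [Matrix.charpoly_of_isUpperTriangular]
  · simp [upperJordan]
  · intro i j hij
    have hij' : j.val < i.val := hij
    have h1 : i ≠ j := fun h => by simp [h] at hij'
    simp only [upperJordan, Matrix.of_apply, if_neg h1]
    rw [if_neg (by omega)]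

theorem trace_upperJordan (q : ℕ) (a : F) : (upperJordan q a).trace = q * a := by
  simp [Matrix.trace, upperJordan]

section Invariants

variable {ι : Type*} [Fintype ι] [DecidableEq ι]

theorem eq_conj_of_apply_eq_mulVec {A : Module.End F U} {A' : Matrix ι ι F} {T : U ≃ₗ[F] (ι → F)}
    (hT : ∀ u, T (A u) = A' *ᵥ T u) : A = T.symm.conj (Matrix.toLin' A') := by
  ext u
  rw [LinearEquiv.conj_apply_apply, Matrix.toLin'_apply, LinearEquiv.symm_symm, ← hT,
    LinearEquiv.symm_apply_apply]

theorem charpoly_eq_of_apply_eq_mulVec [FiniteDimensional F U] {A : Module.End F U} {A' : Matrix ι ι F}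
    {T : U ≃ₗ[F] (ι → F)} (hT : ∀ u, T (A u) = A' *ᵥ T u) : A.charpoly = A'.charpoly := by
  rw [eq_conj_of_apply_eq_mulVec hT, LinearEquiv.charpoly_conj, Matrix.charpoly_toLin']

theorem trace_eq_of_apply_eq_mulVec {A : Module.End F U} {A' : Matrix ι ι F}
    {T : U ≃ₗ[F] (ι → F)} (hT : ∀ u, T (A u) = A' *ᵥ T u) :
    LinearMap.trace F U A = A'.trace := by
  rw [eq_conj_of_apply_eq_mulVec hT, LinearMap.trace_conj', Matrix.trace_toLin'_eq]

end Invariants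

/-- `α` is the top root of `p`: a root such that every root is of the form `α - i c`. -/
def IsTopRoot (p : Polynomial F) (c α : F) : Prop :=
  p.IsRoot α ∧ ∀ μ, p.IsRoot μ → ∃ i : ℕ, μ = α - i * c

theorem IsTopRoot.unique [CharZero F] {p : Polynomial F} {c α β : F} (hc : c ≠ 0)
    (hα : IsTopRoot p c α) (hβ : IsTopRoot p c β) : α = β := by
  obtain ⟨i, hi⟩ := hα.2 β hβ.1
  obtain ⟨j, hj⟩ := hβ.2 α hα.1
  have h : ((i + j : ℕ) : F) * c = 0 := by
    push_cast
    linear_combination hi + hj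
  rw [mul_eq_zero, Nat.cast_eq_zero] at h
  have hi0 : i = 0 := by
    have := h.resolve_right hc
    omega
  rw [hi, hi0]
  simp

theorem isTopRoot_twoBlockA {p q : ℕ} (hp : 1 ≤ p) (α c : F) :
    IsTopRoot (twoBlockA p q α c).charpoly c α := by
  rw [twoBlockA, Matrix.charpoly_fromBlocks_zero₁₂, charpoly_upperJordan, charpoly_upperJordan]
  constructor
  · simp [Polynomial.IsRoot, show p ≠ 0 by omega]
  · intro μ hμ
    rw [Polynomial.IsRoot, Polynomial.eval_mul, mul_eq_zero, Polynomial.eval_pow,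
      Polynomial.eval_pow] at hμ
    rcases hμ with hμ | hμ
    · refine ⟨0, ?_⟩
      have := eq_zero_of_pow_eq_zero hμ
      simp at this
      linear_combination this
    · refine ⟨1, ?_⟩
      have := eq_zero_of_pow_eq_zero hμ
      simp at this
      push_cast
      linear_combination this

theorem isTopRoot_threeBlockA (n : ℕ) (α c : F) :
    IsTopRoot (threeBlockA n α c).charpoly c α := by
  have hu : ∀ a : F, (Matrix.of fun _ _ : Unit => a).charpoly =
      Polynomial.X - Polynomial.C a := by
    intro a
    simp [Matrix.charpoly, Matrix.det_unique]
  rw [threeBlockA, Matrix.charpoly_fromBlocks_zero₁₂, Matrix.charpoly_fromBlocks_zero₁₂,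
    charpoly_upperJordan, hu, hu]
  constructor
  · simp [Polynomial.IsRoot]
  · intro μ hμ
    rw [Polynomial.IsRoot, Polynomial.eval_mul, Polynomial.eval_mul, mul_eq_zero, mul_eq_zero,
      Polynomial.eval_pow] at hμ
    rcases hμ with hμ | hμ | hμ
    · refine ⟨0, ?_⟩
      simp at hμ
      linear_combination hμ
    · refine ⟨1, ?_⟩
      have := eq_zero_of_pow_eq_zero hμ
      simp at this
      push_cast
      linear_combination this
    · refine ⟨2, ?_⟩
      simp at hμ
      push_cast
      linear_combination hμ

theorem isTopRoot_diagonal {l : ℕ} (hl : 1 ≤ l) (α c : F) :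
    IsTopRoot (Matrix.diagonal fun i : Fin l => α - (i.val : F) * c).charpoly c α := by
  rw [Matrix.charpoly_of_isUpperTriangular _ (Matrix.blockTriangular_diagonal _)]
  simp only [IsTopRoot, Polynomial.IsRoot, Polynomial.eval_prod, Finset.prod_eq_zero_iff]
  constructor
  · exact ⟨⟨0, hl⟩, Finset.mem_univ _, by simp⟩
  · rintro μ ⟨i, -, hi⟩
    refine ⟨i.val, ?_⟩
    simp at hi
    linear_combination hi

section Intertwiners

variable {n : ℕ} {α c : F}

theorem apply_elim_zero_eq_smul {p q : ℕ} {s : F}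
    {Z : (Fin p ⊕ Fin q → F) →ₗ[F] (Fin p ⊕ Fin q → F)}
    (h : ∀ i : Fin p, Z (Pi.single (Sum.inl i) 1) = s • Pi.single (Sum.inl i) 1)
    (w : Fin p → F) : Z (Sum.elim w 0) = s • Sum.elim w 0 := by
  have hw : (Sum.elim w 0 : Fin p ⊕ Fin q → F) = ∑ i, w i • Pi.single (Sum.inl i) 1 := by
    ext j
    rcases j with j | j <;> simp [Finset.sum_apply, Pi.single_apply]
  rw [hw, map_sum, Finset.smul_sum]
  refine Finset.sum_congr rfl fun i _ => ?_
  rw [map_smul, h, smul_comm]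

theorem cornerN_mulVec_last {k : ℕ} (hk : 1 ≤ k) (hkn : k ≤ n)
    (X : Matrix (Fin (k - 1)) (Fin (n - k)) F) (w : Fin (n + 1 - k) → F) :
    (cornerN X *ᵥ w) ⟨k - 1, by omega⟩ = w ⟨0, by omega⟩ := by
  rw [Matrix.mulVec, dotProduct, Finset.sum_eq_single (⟨0, by omega⟩ : Fin (n + 1 - k))]
  · simp [cornerN]
  · intro j _ hj
    have : j.val ≠ 0 := fun h0 => hj (Fin.ext h0)
    simp [cornerN, this]
  · simp

theorem cornerN_mulVec_single {k : ℕ} (hk : 1 ≤ k) (hkn : k ≤ n)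
    (X : Matrix (Fin (k - 1)) (Fin (n - k)) F) :
    cornerN X *ᵥ (Pi.single ⟨0, by omega⟩ 1) = Pi.single ⟨k - 1, by omega⟩ 1 := by
  ext i
  rw [Matrix.mulVec_single_one, Matrix.col_apply, Pi.single_apply]
  simp [cornerN, Fin.ext_iff]

theorem cornerN_injective {k : ℕ} {X X' : Matrix (Fin (k - 1)) (Fin (n - k)) F}
    (h : cornerN X = cornerN X') : X = X' := by
  ext i j
  have := congr_fun (congr_fun h ⟨i.val, by omega⟩) ⟨j.val + 1, by omega⟩
  simpa [cornerN] using this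

/-- An isomorphism between two of the two-block representations with the same `α` and `k` is a
scalar `s` on the first block and modulo the first block: it is a scalar on the eigenvector of the
second block, hence on the image of that vector under `v_0`, which is a cyclic vector of the first
block; the last row `(1, 0, …, 0)` of the corner then gives the claim modulo the first block. -/
theorem cornerN_eq_of_intertwines (hc : c ≠ 0) {k : ℕ} (hk : 1 ≤ k) (hkn : k ≤ n)
    {X X' : Matrix (Fin (k - 1)) (Fin (n - k)) F}
    (Z : (Fin k ⊕ Fin (n + 1 - k) → F) ≃ₗ[F] (Fin k ⊕ Fin (n + 1 - k) → F))
    (hA : ∀ w, Z (twoBlockA k (n + 1 - k) α c *ᵥ w) = twoBlockA k (n + 1 - k) α c *ᵥ Z w)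
    (hE : ∀ w, Z (Matrix.fromBlocks 0 (cornerN X) 0 0 *ᵥ w) =
      Matrix.fromBlocks 0 (cornerN X') 0 0 *ᵥ Z w) : X = X' := by
  have hAw : ∀ w : Fin k ⊕ Fin (n + 1 - k) → F, twoBlockA k (n + 1 - k) α c *ᵥ w =
      Sum.elim (upperJordan k 0 *ᵥ (w ∘ Sum.inl) + α • (w ∘ Sum.inl))
        (upperJordan (n + 1 - k) 0 *ᵥ (w ∘ Sum.inr) + (α - c) • (w ∘ Sum.inr)) := by
    intro w
    rw [twoBlockA, Matrix.fromBlocks_mulVec, upperJordan_mulVec k, upperJordan_mulVec (n + 1 - k)]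
    simp
  have hEw : ∀ (Y : Matrix (Fin (k - 1)) (Fin (n - k)) F) (w : Fin k ⊕ Fin (n + 1 - k) → F),
      (Matrix.fromBlocks 0 (cornerN Y) 0 0 : Matrix (Fin k ⊕ Fin (n + 1 - k)) _ F) *ᵥ w =
        Sum.elim (cornerN Y *ᵥ (w ∘ Sum.inr)) 0 := by
    intro Y w
    rw [Matrix.fromBlocks_mulVec]
    simp
  have hq : 0 < n + 1 - k := by omega
  let e : Fin k ⊕ Fin (n + 1 - k) → F := Sum.elim 0 (Pi.single ⟨0, hq⟩ 1)
  have hJ0 : upperJordan (n + 1 - k) (0 : F) *ᵥ (Pi.single ⟨0, hq⟩ 1) = 0 := by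
    ext i
    rw [upperJordan_zero_mulVec_apply]
    split_ifs
    · simp
    · rfl
  have hAe : twoBlockA k (n + 1 - k) α c *ᵥ e = (α - c) • e := by
    rw [hAw]
    ext i
    rcases i with i | i <;> simp [e, hJ0, -Sum.elim_zero_single]
  have hZe := hA e
  rw [hAe, map_smul, hAw] at hZe
  have hl : Z e ∘ Sum.inl = 0 := by
    refine eq_zero_of_upperJordan_mulVec_eq_smul (neg_ne_zero.mpr hc) ?_
    ext i
    have := congr_fun hZe (Sum.inl i)
    simp only [Pi.smul_apply, smul_eq_mul, Sum.elim_inl, Pi.add_apply, Function.comp_apply]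
      at this ⊢
    linear_combination -this
  have hr := eq_smul_single_of_upperJordan_mulVec_eq_zero hq (w := Z e ∘ Sum.inr) (by
    ext i
    have := congr_fun hZe (Sum.inr i)
    simp only [Pi.smul_apply, smul_eq_mul, Sum.elim_inr, Pi.add_apply, Function.comp_apply,
      Pi.zero_apply] at this ⊢
    linear_combination -this)
  set s := (Z e ∘ Sum.inr) ⟨0, hq⟩
  have hZe' : Z e = s • e := by
    ext i
    rcases i with i | i
    · simpa [e] using congr_fun hl i
    · simpa [e, -Sum.elim_zero_single] using congr_fun hr i
  have hs : s ≠ 0 := by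
    intro hs
    rw [hs, zero_smul, ← map_zero Z] at hZe'
    have := congr_fun (Z.injective hZe') (Sum.inr ⟨0, hq⟩)
    simp [e] at this
  have hsingle : ∀ i : Fin k, (Pi.single (Sum.inl i) 1 : Fin k ⊕ Fin (n + 1 - k) → F) =
      Sum.elim (Pi.single i 1) 0 := by
    intro i
    ext j
    rcases j with j | j <;> simp [Pi.single_apply]
  have hlast : Z (Pi.single (Sum.inl ⟨k - 1, by omega⟩) 1) =
      s • Pi.single (Sum.inl ⟨k - 1, by omega⟩) 1 := by
    have h1 : ∀ Y : Matrix (Fin (k - 1)) (Fin (n - k)) F,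
        (Matrix.fromBlocks 0 (cornerN Y) 0 0 : Matrix (Fin k ⊕ Fin (n + 1 - k)) _ F) *ᵥ e =
          Pi.single (Sum.inl ⟨k - 1, by omega⟩) 1 := by
      intro Y
      rw [hEw, hsingle]
      congr 1
      exact cornerN_mulVec_single hk hkn Y
    rw [← h1 X, hE, hZe', Matrix.mulVec_smul, h1 X', h1 X]
  have hinl : ∀ d, ∀ i : Fin k, i.val + d = k - 1 →
      Z (Pi.single (Sum.inl i) 1) = s • Pi.single (Sum.inl i) 1 := by
    intro d
    induction d with
    | zero =>
      intro i hi
      have : i = ⟨k - 1, by omega⟩ := Fin.ext (by simpa using hi)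
      rw [this]
      exact hlast
    | succ d ih =>
      intro i hi
      have h1 := ih ⟨i.val + 1, by omega⟩ (by simp; omega)
      have h2 : (Pi.single (Sum.inl i) 1 : Fin k ⊕ Fin (n + 1 - k) → F) =
          twoBlockA k (n + 1 - k) α c *ᵥ Pi.single (Sum.inl ⟨i.val + 1, by omega⟩) 1 -
            α • Pi.single (Sum.inl ⟨i.val + 1, by omega⟩) 1 := by
        rw [hAw, hsingle, hsingle]
        ext j
        rcases j with j | j
        · simp only [Sum.elim_comp_inl, Sum.elim_comp_inr, Sum.elim_inl, Pi.sub_apply,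
            Pi.add_apply, Pi.smul_apply, add_sub_cancel_right]
          rw [upperJordan_zero_mulVec_apply]
          simp only [Pi.single_apply, Fin.ext_iff]
          split_ifs <;> first | rfl | omega
        · simp [-Sum.elim_single_zero]
      rw [h2, map_sub, hA, map_smul, h1, Matrix.mulVec_smul, smul_sub, smul_comm α s]
  have hZinl := apply_elim_zero_eq_smul (Z := Z.toLinearMap) fun i => hinl (k - 1 - i.val) i (by omega)
  have hEZ : ∀ w, cornerN X' *ᵥ (Z w ∘ Sum.inr) = s • (cornerN X *ᵥ (w ∘ Sum.inr)) := by
    intro w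
    have h1 := hE w
    rw [hEw, hEw] at h1
    have h2 := h1.symm.trans (hZinl _)
    ext i
    simpa using congr_fun h2 (Sum.inl i)
  have hZinr : ∀ l (hl : l < n + 1 - k) w, Z w (Sum.inr ⟨l, hl⟩) = s * w (Sum.inr ⟨l, hl⟩) := by
    intro l
    induction l with
    | zero =>
      intro hl w
      have h1 := congr_fun (hEZ w) ⟨k - 1, by omega⟩
      rw [cornerN_mulVec_last hk hkn, Pi.smul_apply, cornerN_mulVec_last hk hkn] at h1
      exact h1
    | succ l ih =>
      intro hl w
      have h1 := ih (by omega) (twoBlockA k (n + 1 - k) α c *ᵥ w)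
      have h2 := ih (by omega) w
      rw [hA, hAw, hAw] at h1
      simp only [Sum.elim_inr, Pi.add_apply, Pi.smul_apply, Function.comp_apply, smul_eq_mul]
        at h1
      rw [upperJordan_zero_mulVec_apply, upperJordan_zero_mulVec_apply, dif_pos hl, dif_pos hl,
        h2] at h1
      simp only [Function.comp_apply] at h1
      linear_combination h1
  apply cornerN_injective
  ext i j
  have h1 := congr_fun (hEZ (Sum.elim 0 (Pi.single j 1))) i
  have h2 : Z (Sum.elim 0 (Pi.single j 1)) ∘ Sum.inr = s • Pi.single j 1 := by
    ext l
    have := hZinr l.val l.isLt (Sum.elim 0 (Pi.single j 1))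
    simpa using this
  rw [h2, Sum.elim_comp_inr, Matrix.mulVec_smul, Matrix.mulVec_single_one,
    Matrix.mulVec_single_one, Pi.smul_apply, Pi.smul_apply, smul_eq_mul, smul_eq_mul] at h1
  exact (mul_left_cancel₀ hs h1).symm

/-- An isomorphism between two of the three-block representations with the same `α` is a scalar:
it is a scalar on the eigenvector of the last block, whose images span. -/
theorem eq_of_intertwines_threeBlock (hc : c ≠ 0) [CharZero F] (hn : 1 ≤ n) {a a' : Fin n → F}
    (ha : a ⟨0, hn⟩ = 1) (ha' : a' ⟨0, hn⟩ = 1)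
    (Z : (ThreeIdx n → F) ≃ₗ[F] (ThreeIdx n → F))
    (hA : ∀ w, Z (threeBlockA n α c *ᵥ w) = threeBlockA n α c *ᵥ Z w)
    (hE : ∀ w, Z (threeBlockE a (lastVec F n) *ᵥ w) =
      threeBlockE a' (lastVec F n) *ᵥ Z w) : a = a' := by
  have hAw : ∀ w : ThreeIdx n → F, threeBlockA n α c *ᵥ w =
      Sum.elim (fun _ => α * w (Sum.inl ())) (Sum.elim
        (upperJordan n 0 *ᵥ (fun i => w (Sum.inr (Sum.inl i))) +
          (α - c) • fun i => w (Sum.inr (Sum.inl i)))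
        (fun _ => (α - 2 * c) * w (Sum.inr (Sum.inr ())))) := by
    intro w
    rw [threeBlockA, Matrix.fromBlocks_mulVec, Matrix.fromBlocks_mulVec, upperJordan_mulVec n]
    ext i
    rcases i with i | i | i
    · simp [Matrix.mulVec, dotProduct]
    · simp [Function.comp_def]
    · simp [Matrix.mulVec, dotProduct]
  have hEw : ∀ (b : Fin n → F) (w : ThreeIdx n → F), threeBlockE b (lastVec F n) *ᵥ w =
      Sum.elim (fun _ => b ⬝ᵥ fun i => w (Sum.inr (Sum.inl i)))
        (Sum.elim (w (Sum.inr (Sum.inr ())) • lastVec F n) 0) := by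
    intro b w
    ext i
    rcases i with i | i | i
    · simp [threeBlockE, Matrix.mulVec, dotProduct]
    · simp [threeBlockE, Matrix.mulVec, dotProduct, mul_comm]
    · simp [threeBlockE, Matrix.mulVec, dotProduct]
  let e : ThreeIdx n → F := Sum.elim 0 (Sum.elim 0 (fun _ => 1))
  let g : Fin n → ThreeIdx n → F := fun i => Sum.elim 0 (Sum.elim (Pi.single i 1) 0)
  let d : ThreeIdx n → F := Sum.elim (fun _ => 1) 0
  have hAe : threeBlockA n α c *ᵥ e = (α - 2 * c) • e := by
    rw [hAw]
    ext i
    rcases i with i | i | i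
    · simp [e]
    · simp [e, Matrix.mulVec, dotProduct]
    · simp [e]
  have hZe := hA e
  rw [hAe, map_smul, hAw] at hZe
  have h0 : Z e (Sum.inl ()) = 0 := by
    have := congr_fun hZe (Sum.inl ())
    simp only [Pi.smul_apply, smul_eq_mul, Sum.elim_inl] at this
    have h2 : (2 * c) * Z e (Sum.inl ()) = 0 := by linear_combination -this
    exact (mul_eq_zero.mp h2).resolve_left (mul_ne_zero two_ne_zero hc)
  have h1 : (fun i => Z e (Sum.inr (Sum.inl i))) = 0 := by
    refine eq_zero_of_upperJordan_mulVec_eq_smul (neg_ne_zero.mpr hc) ?_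
    ext i
    have := congr_fun hZe (Sum.inr (Sum.inl i))
    simp only [Pi.smul_apply, smul_eq_mul, Sum.elim_inl, Sum.elim_inr, Pi.add_apply] at this ⊢
    linear_combination -this
  set r := Z e (Sum.inr (Sum.inr ())) with hr_def
  have hZe' : Z e = r • e := by
    ext i
    rcases i with i | i | i
    · simpa [e] using h0
    · simpa [e] using congr_fun h1 i
    · simp [e, hr_def]
  have hr : r ≠ 0 := by
    intro hr
    rw [hr, zero_smul, ← map_zero Z] at hZe'
    have := congr_fun (Z.injective hZe') (Sum.inr (Sum.inr ()))
    simp [e] at this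
  have hlastVec : lastVec F n = Pi.single ⟨n - 1, by omega⟩ 1 := by
    ext i
    simp only [lastVec, Pi.single_apply, Fin.ext_iff]
    congr 1
    apply propext
    omega
  have hEe : ∀ b, threeBlockE b (lastVec F n) *ᵥ e = g ⟨n - 1, by omega⟩ := by
    intro b
    rw [hEw, hlastVec]
    ext i
    rcases i with i | i | i <;> simp [e, g, dotProduct, Pi.single_apply]
  have hEg : ∀ (b : Fin n → F) i, threeBlockE b (lastVec F n) *ᵥ g i = b i • d := by
    intro b i
    rw [hEw]
    ext j
    rcases j with j | j | j <;> simp [g, d, dotProduct, Pi.single_apply]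
  have hg : ∀ k, ∀ i : Fin n, i.val + k = n - 1 → Z (g i) = r • g i := by
    intro k
    induction k with
    | zero =>
      intro i hi
      have : i = ⟨n - 1, by omega⟩ := Fin.ext (by simpa using hi)
      rw [this, ← hEe a, hE, hZe', Matrix.mulVec_smul, hEe, hEe]
    | succ k ih =>
      intro i hi
      have h1 := ih ⟨i.val + 1, by omega⟩ (by simp; omega)
      have h2 : g i = threeBlockA n α c *ᵥ g ⟨i.val + 1, by omega⟩ -
          (α - c) • g ⟨i.val + 1, by omega⟩ := by
        rw [hAw]
        ext j
        rcases j with j | j | j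
        · simp [g]
        · simp only [g, Sum.elim_inr, Sum.elim_inl, Pi.sub_apply, Pi.add_apply, Pi.smul_apply,
            add_sub_cancel_right]
          rw [upperJordan_zero_mulVec_apply]
          simp only [Pi.single_apply, Fin.ext_iff]
          split_ifs <;> first | rfl | omega
        · simp [g]
      rw [h2, map_sub, hA, map_smul, h1, Matrix.mulVec_smul, smul_sub, smul_comm (α - c) r]
  have hZg : ∀ i, Z (g i) = r • g i := fun i => hg (n - 1 - i.val) i (by omega)
  have hZd : ∀ i, a i • Z d = (r * a' i) • d := by
    intro i
    rw [← map_smul, ← hEg a, hE, hZg, Matrix.mulVec_smul, hEg, smul_smul]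
  have hZd0 := hZd ⟨0, hn⟩
  rw [ha, ha', one_smul, mul_one] at hZd0
  ext i
  have h2 := congr_fun (hZd i) (Sum.inl ())
  rw [hZd0] at h2
  simp only [d, Pi.smul_apply, Sum.elim_inl, smul_eq_mul, mul_one] at h2
  exact mul_left_cancel₀ hr (by rw [← h2, mul_comm])

end Intertwiners

end Uniqueness

/-! ### The classification -/

section Classification

variable {F V U : Type*} [Field F] [LieRing V] [LieAlgebra F V] [IsLieAbelian V]
  [AddCommGroup U] [Module F U] {n : ℕ} {x : Module.End F V} {v : Module.Basis (Fin n) F V} {c : F}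

theorem finrank_eq_card_of_isoToMatrixRep {ι : Type*} [Fintype ι] [DecidableEq ι]
    {R : LineSemidirect x →ₗ⁅F⁆ Module.End F U} {S : LineSemidirect x →ₗ⁅F⁆ Matrix ι ι F}
    (h : IsoToMatrixRep R S) : Module.finrank F U = Fintype.card ι := by
  obtain ⟨T, -⟩ := h
  rw [T.finrank_eq, Module.finrank_fintype_fun_eq_card]

theorem trace_fromBlocks_diagonal {ι κ : Type*} [Fintype ι] [Fintype κ] (M : Matrix ι ι F)
    (N : Matrix κ κ F) : (Matrix.fromBlocks M 0 0 N).trace = M.trace + N.trace := by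
  simp [Matrix.trace]

theorem finrank_of_isoToMatrixRep_repR {hx : LinearMap.toMatrix v v x = lowerJordan n c}
    {R : LineSemidirect x →ₗ⁅F⁆ Module.End F U} {α : F} {k : ℕ} {hk : 1 ≤ k} {hkn : k ≤ n}
    {X : Matrix (Fin (k - 1)) (Fin (n - k)) F}
    (h : IsoToMatrixRep R (repR hx α k hk hkn X)) : Module.finrank F U = n + 1 := by
  rw [finrank_eq_card_of_isoToMatrixRep h, Fintype.card_sum, Fintype.card_fin, Fintype.card_fin]
  omega

theorem finrank_of_isoToMatrixRep_repRa {hx : LinearMap.toMatrix v v x = lowerJordan n c}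
    {R : LineSemidirect x →ₗ⁅F⁆ Module.End F U} {α : F} {a : Fin n → F} {hn : Odd n}
    {ha : ∀ i : Fin n, Even (i.val + 1) → a i = 0}
    (h : IsoToMatrixRep R (repRa hx α a hn ha)) : Module.finrank F U = n + 2 := by
  rw [finrank_eq_card_of_isoToMatrixRep h]
  simp only [Fintype.card_sum, Fintype.card_fin, Fintype.card_unit]
  omega

/-- The eigenvalue `α` and the trace `k α + (n + 1 - k) (α - c)` of the image of `x` determine the
parameters `α` and `k`. -/
theorem repR_param_unique [CharZero F] [FiniteDimensional F U] (hc : c ≠ 0)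
    {hx : LinearMap.toMatrix v v x = lowerJordan n c}
    {R : LineSemidirect x →ₗ⁅F⁆ Module.End F U} {α β : F} {k l : ℕ} {hk : 1 ≤ k} {hkn : k ≤ n}
    {hl : 1 ≤ l} {hln : l ≤ n} {X : Matrix (Fin (k - 1)) (Fin (n - k)) F}
    {Y : Matrix (Fin (l - 1)) (Fin (n - l)) F}
    (h : IsoToMatrixRep R (repR hx α k hk hkn X)) (h' : IsoToMatrixRep R (repR hx β l hl hln Y)) :
    α = β ∧ k = l := by
  obtain ⟨T, hTA, -⟩ := exists_coord_of_isoToMatrixRep_jordanRep (hk.trans hkn) hx h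
  obtain ⟨S, hSA, -⟩ := exists_coord_of_isoToMatrixRep_jordanRep (hk.trans hkn) hx h'
  have hα := isTopRoot_twoBlockA (q := n + 1 - k) hk α c
  have hβ := isTopRoot_twoBlockA (q := n + 1 - l) hl β c
  rw [← charpoly_eq_of_apply_eq_mulVec hTA] at hα
  rw [← charpoly_eq_of_apply_eq_mulVec hSA] at hβ
  obtain rfl := hα.unique hc hβ
  refine ⟨rfl, ?_⟩
  have htr := (trace_eq_of_apply_eq_mulVec hTA).symm.trans (trace_eq_of_apply_eq_mulVec hSA)
  rw [twoBlockA, twoBlockA, trace_fromBlocks_diagonal, trace_fromBlocks_diagonal, trace_upperJordan,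
    trace_upperJordan, trace_upperJordan, trace_upperJordan, Nat.cast_sub (by omega),
    Nat.cast_sub (by omega)] at htr
  have h1 : ((k : F) - l) * c = 0 := by linear_combination htr
  have h2 := sub_eq_zero.mp ((mul_eq_zero.mp h1).resolve_right hc)
  exact_mod_cast h2

theorem repR_matrix_unique (hc : c ≠ 0) {hx : LinearMap.toMatrix v v x = lowerJordan n c}
    {R : LineSemidirect x →ₗ⁅F⁆ Module.End F U} {α : F} {k : ℕ} {hk : 1 ≤ k} {hkn : k ≤ n}
    {X Y : Matrix (Fin (k - 1)) (Fin (n - k)) F}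
    (h : IsoToMatrixRep R (repR hx α k hk hkn X)) (h' : IsoToMatrixRep R (repR hx α k hk hkn Y)) :
    X = Y := by
  obtain ⟨T, hTA, hTE⟩ := exists_coord_of_isoToMatrixRep_jordanRep (hk.trans hkn) hx h
  obtain ⟨S, hSA, hSE⟩ := exists_coord_of_isoToMatrixRep_jordanRep (hk.trans hkn) hx h'
  refine cornerN_eq_of_intertwines (α := α) hc hk hkn (T.symm ≪≫ₗ S) (fun w => ?_) (fun w => ?_)
  · obtain ⟨u, rfl⟩ := T.surjective w
    simp only [LinearEquiv.trans_apply, LinearEquiv.symm_apply_apply, ← hTA, ← hSA]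
  · obtain ⟨u, rfl⟩ := T.surjective w
    simp only [LinearEquiv.trans_apply, LinearEquiv.symm_apply_apply, ← hTE, ← hSE]

theorem repRa_param_unique [CharZero F] [FiniteDimensional F U] (hc : c ≠ 0)
    {hx : LinearMap.toMatrix v v x = lowerJordan n c}
    {R : LineSemidirect x →ₗ⁅F⁆ Module.End F U} {α β : F} {a b : Fin n → F} {hn : Odd n}
    {ha : ∀ i : Fin n, Even (i.val + 1) → a i = 0} {hb : ∀ i : Fin n, Even (i.val + 1) → b i = 0}
    (ha1 : ∀ i : Fin n, i.val + 1 = 1 → a i = 1) (hb1 : ∀ i : Fin n, i.val + 1 = 1 → b i = 1)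
    (h : IsoToMatrixRep R (repRa hx α a hn ha)) (h' : IsoToMatrixRep R (repRa hx β b hn hb)) :
    α = β ∧ a = b := by
  have hn1 : 1 ≤ n := hn.pos
  obtain ⟨T, hTA, hTE⟩ := exists_coord_of_isoToMatrixRep_jordanRep hn1 hx h
  obtain ⟨S, hSA, hSE⟩ := exists_coord_of_isoToMatrixRep_jordanRep hn1 hx h'
  have hα := isTopRoot_threeBlockA n α c
  have hβ := isTopRoot_threeBlockA n β c
  rw [← charpoly_eq_of_apply_eq_mulVec hTA] at hα
  rw [← charpoly_eq_of_apply_eq_mulVec hSA] at hβ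
  obtain rfl := hα.unique hc hβ
  refine ⟨rfl, eq_of_intertwines_threeBlock (α := α) hc hn1 (ha1 _ rfl) (hb1 _ rfl)
    (T.symm ≪≫ₗ S) (fun w => ?_) (fun w => ?_)⟩
  · obtain ⟨u, rfl⟩ := T.surjective w
    simp only [LinearEquiv.trans_apply, LinearEquiv.symm_apply_apply, ← hTA, ← hSA]
  · obtain ⟨u, rfl⟩ := T.surjective w
    simp only [LinearEquiv.trans_apply, LinearEquiv.symm_apply_apply, ← hTE, ← hSE]

theorem isoToListed_unique [CharZero F] [FiniteDimensional F U] (hc : c ≠ 0) (hn : 1 < n)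
    (hx : LinearMap.toMatrix v v x = lowerJordan n c)
    {R : LineSemidirect x →ₗ⁅F⁆ Module.End F U} {p p' : RepParam F n}
    (h : IsoToListed hn hx R p) (h' : IsoToListed hn hx R p') : p = p' := by
  have htwo : ∀ {α k hk hkn X}, IsoToMatrixRep R (repR hx α k hk hkn X) →
      ∀ {β a hodd ha}, IsoToMatrixRep R (repRa hx β a hodd ha) → False := by
    intro α k hk hkn X h1 β a hodd ha h2
    have h3 := finrank_of_isoToMatrixRep_repR h1
    have h4 := finrank_of_isoToMatrixRep_repRa h2
    omega
  rcases p with ⟨α, k, hk, hkn, X⟩ | α | α | ⟨α, a, hodd, ha1, ha⟩ <;>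
    rcases p' with ⟨β, l, hl, hln, Y⟩ | β | β | ⟨β, b, hodd', hb1, hb⟩ <;>
    simp only [IsoToListed] at h h'
  case mid.mid =>
    obtain ⟨rfl, rfl⟩ := repR_param_unique hc h h'
    obtain rfl := repR_matrix_unique hc h h'
    rfl
  case top.top =>
    obtain ⟨rfl, -⟩ := repR_param_unique hc h h'
    rfl
  case bot.bot =>
    obtain ⟨rfl, -⟩ := repR_param_unique hc h h'
    rfl
  case three.three =>
    obtain ⟨rfl, rfl⟩ := repRa_param_unique hc ha1 hb1 h h'
    rfl
  all_goals first
    | exact (htwo h h').elim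
    | exact (htwo h' h).elim
    | (have := (repR_param_unique hc h h').2
       omega)

theorem exists_isoToListed_of_repR (hn : 1 < n)
    (hx : LinearMap.toMatrix v v x = lowerJordan n c)
    {R : LineSemidirect x →ₗ⁅F⁆ Module.End F U} {α : F} {k : ℕ} {hk : 1 ≤ k} {hkn : k ≤ n}
    {X : Matrix (Fin (k - 1)) (Fin (n - k)) F}
    (h : IsoToMatrixRep R (repR hx α k hk hkn X)) : ∃ p, IsoToListed hn hx R p := by
  rcases Nat.lt_or_eq_of_le hk with hk1 | rfl
  · rcases Nat.lt_or_eq_of_le hkn with hkn' | rfl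
    · exact ⟨.mid α k hk1 hkn' X, h⟩
    · have hX : X = 0 := by
        ext i j
        exact absurd j.isLt (by omega)
      exact ⟨.top α, by subst hX; exact h⟩
  · have hX : X = 0 := by
      ext i j
      exact absurd i.isLt (by omega)
    exact ⟨.bot α, by subst hX; exact h⟩

theorem exists_isoToListed [IsAlgClosed F] [CharZero F] [FiniteDimensional F U] (hc : c ≠ 0)
    (hn : 1 < n) (hx : LinearMap.toMatrix v v x = lowerJordan n c)
    {R : LineSemidirect x →ₗ⁅F⁆ Module.End F U} (hfaithful : Function.Injective R)
    (huniserial : IsUniserialRep R) : ∃ p, IsoToListed hn hx R p := by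
  have := huniserial.1
  have h := isUniserialSystem_of_isUniserialRep hx huniserial
  obtain ⟨α, m, hL⟩ := h.exists_hasLayers hc
  rcases h.layerDim_cases hc hL hn (repB_last_ne_zero hfaithful hn.le) with
    ⟨rfl, hsum⟩ | ⟨rfl, h0, h1, h2⟩
  · have hp := layerDim_pos hL (Nat.zero_le 1)
    have hq := layerDim_pos hL (le_refl 1)
    obtain ⟨X, T, hTA, hTE⟩ := h.exists_coord_of_two_layers hc hL rfl hp (by omega) (by omega)
    exact exists_isoToListed_of_repR hn hx (hk := hp) (hkn := by omega)
      (h := isoToMatrixRep_jordanRep hx (adShift_twoBlock_nilpotent hp (by omega) (by omega) α c _)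
        (fun i j => adShift_twoBlock_commute _ _ α c _ i.val j.val) T hTA hTE)
  · obtain ⟨a, T, ha1, hTA, hTE⟩ := h.exists_coord_of_three_layers hc hL hn.le h0 h1 h2
    have hB := apply_B_eq_adShift_mulVec (T := T.toLinearMap) h.lie hTA hTE
    simp only [LinearEquiv.coe_coe] at hB
    obtain ⟨hodd, ha⟩ := odd_and_eq_zero_of_commute (α := α) (c := c) hn.le ha1 (by
      intro i
      refine Matrix.ext_of_mulVec_single fun j => ?_
      obtain ⟨u, hu⟩ := T.surjective (Pi.single j 1)
      rw [← hu, ← Matrix.mulVec_mulVec, ← Matrix.mulVec_mulVec, ← hB, ← hTE, ← hTE, ← hB,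
        ← Module.End.mul_apply, h.comm, Module.End.mul_apply])
    refine ⟨.three α a hodd (fun i hi => ?_) ha, ?_⟩
    · rw [show i = ⟨0, hn.le⟩ from Fin.ext (by simpa using hi), ha1]
    · exact isoToMatrixRep_jordanRep hx (adShift_threeBlock_nilpotent n α c _ _)
        (fun i j => adShift_threeBlock_commute α c a hodd ha i.val j.val) T hTA hTE

theorem existsUnique_isoToMatrixRep_repT [IsAlgClosed F] [CharZero F] [FiniteDimensional F U]
    (hc : c ≠ 0) (hn : n = 1) (hx : LinearMap.toMatrix v v x = lowerJordan n c)
    {R : LineSemidirect x →ₗ⁅F⁆ Module.End F U} (hfaithful : Function.Injective R)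
    (huniserial : IsUniserialRep R) :
    ∃! p : F × {l : ℕ // 2 ≤ l}, IsoToMatrixRep R (repT hx hn p.1 p.2.val) := by
  subst hn
  have := huniserial.1
  have h := isUniserialSystem_of_isUniserialRep hx huniserial
  obtain ⟨α, m, hL⟩ := h.exists_hasLayers hc
  obtain ⟨hm, T, hTA, hTE⟩ := h.exists_coord_of_one hc hL (repB_last_ne_zero hfaithful le_rfl)
  have hiso : IsoToMatrixRep R (repT hx rfl α (m + 1)) := isoToMatrixRep_jordanRep hx _ _ T hTA hTE
  refine ⟨(α, ⟨m + 1, by omega⟩), hiso, ?_⟩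
  rintro ⟨β, l, hl⟩ h'
  simp only at h'
  have hlm : l = m + 1 := by
    have h1 := finrank_eq_card_of_isoToMatrixRep hiso
    have h2 := finrank_eq_card_of_isoToMatrixRep h'
    rw [Fintype.card_fin] at h1 h2
    omega
  obtain ⟨S, hSA, -⟩ := exists_coord_of_isoToMatrixRep_jordanRep le_rfl hx h'
  have hα := isTopRoot_diagonal (l := m + 1) (by omega) α c
  have hβ := isTopRoot_diagonal (l := l) (by omega) β c
  rw [← charpoly_eq_of_apply_eq_mulVec hTA] at hα
  rw [← charpoly_eq_of_apply_eq_mulVec hSA] at hβ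
  simp only [Prod.mk.injEq, Subtype.mk.injEq]
  exact ⟨hβ.unique hc hα, hlm⟩

end Classification

theorem theorem3p2 {F : Type*} [Field F] [IsAlgClosed F] [CharZero F]
    {V : Type*} [LieRing V] [LieAlgebra F V] [IsLieAbelian V]
    (x : Module.End F V) (n : ℕ) (v : Module.Basis (Fin n) F V) (c : F) (hc : c ≠ 0)
    (hx : LinearMap.toMatrix v v x = lowerJordan n c)
    {U : Type*} [AddCommGroup U] [Module F U] [FiniteDimensional F U]
    (R : LineSemidirect x →ₗ⁅F⁆ Module.End F U)
    (hfaithful : Function.Injective R) (huniserial : IsUniserialRep R) :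
    (∀ hn : 1 < n, ∃! p : RepParam F n, IsoToListed hn hx R p) ∧
    (∀ hn : n = 1, ∃! p : F × {l : ℕ // 2 ≤ l}, IsoToMatrixRep R (repT hx hn p.1 p.2.val)) := by
  refine ⟨fun hn => ?_, fun hn => existsUnique_isoToMatrixRep_repT hc hn hx hfaithful huniserial⟩
  obtain ⟨p, hp⟩ := exists_isoToListed hc hn hx hfaithful huniserial
  exact ⟨p, hp, fun p' hp' => isoToListed_unique hc hn hx hp' hp⟩
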